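/- Let $d\ge 2$ and let $K\subset\mathbb R^d$ be a bounded convex set with nonempty interior. Let $P_1,P_2,\dots$ be independent random points, each uniformly distributed in $K$. For $n\ge 3$ let $\varphi_{n,K}$ be the maximum, over all three-element subsets $\{i,j,k\}$ of $\{1,\dots,n\}$, of the largest angle (in $[0,\pi]$) of the triangle $P_iP_jP_k$. Put $$\rho_d=\frac{\pi^{d/2}\,\Gamma(d)}{2^{2d-1}\,\Gamma\big(\tfrac{d+1}2\big)\,\Gamma\big(d+\tfrac12\big)},\qquad \lambda_d(K)=3\rho_d\,\frac{\mathbb E\|P_1-P_2\|^d}{\mathrm{Vol}_d(K)},$$ where $\|\cdot\|$ is the Euclidean norm and $\mathrm{Vol}_d$ is Lebesgue measure on $\mathbb R^d$. Then the random variable $$Y_{n,d}=\lambda_d(K)\,\frac{n^3}{3!}\,(\pi-\varphi_{n,K})^{d-1}$$ converges in distribution, as $n\to\infty$, to a standard exponential random variable. In particular $\mathbb P(Y_{n,d}>a)\to e^{-a}$ for every real $a>0$, and this convergence is uniform in $a>0$. -/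

import Mathlib

open MeasureTheory ProbabilityTheory Filter Topology
open scoped EuclideanGeometry

noncomputable section

/-- The constant `ρ_d = π^{d/2} Γ(d) / (2^{2d-1} Γ((d+1)/2) Γ(d+1/2))` (used for `d ≥ 2`). -/
def angleRho (d : ℕ) : ℝ :=
  Real.pi ^ ((d : ℝ) / 2) * Real.Gamma (d : ℝ) /
    (2 ^ (2 * d - 1) * Real.Gamma (((d : ℝ) + 1) / 2) * Real.Gamma ((d : ℝ) + 1 / 2))

/-- The uniform distribution on `K ⊆ ℝ^d`: normalized Lebesgue measure restricted to `K`. -/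
def uniformLaw {d : ℕ} (K : Set (EuclideanSpace ℝ (Fin d))) :
    Measure (EuclideanSpace ℝ (Fin d)) :=
  ProbabilityTheory.cond volume K

/-- The elongation `λ_d(K) = 3 ρ_d E|P₁P₂|^d / V_d(K)`, with `P₁, P₂` independent and uniform
in `K`. -/
def elongation {d : ℕ} (K : Set (EuclideanSpace ℝ (Fin d))) : ℝ :=
  3 * angleRho d * (∫ z, ‖z.1 - z.2‖ ^ d ∂((uniformLaw K).prod (uniformLaw K))) / volume.real K

/-- `T_n`: the set of all three-element subsets of the index set `{0, …, n - 1}`. -/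
def triples (n : ℕ) : Finset (Finset ℕ) :=
  (Finset.range n).powersetCard 3

/-- `X_t`: the largest angle of the triangle with vertices `p i`, `i ∈ t` (for `t` with three
elements). The set on the right is finite, so the supremum is a maximum. -/
def triangleMaxAngle {d : ℕ} (p : ℕ → EuclideanSpace ℝ (Fin d)) (t : Finset ℕ) : ℝ :=
  sSup {θ : ℝ | ∃ i ∈ t, ∃ j ∈ t, ∃ k ∈ t, i ≠ j ∧ j ≠ k ∧ i ≠ k ∧ θ = ∠ (p i) (p j) (p k)}

/-- `φ_n = max_{t ∈ T_n} X_t`: the largest angle in all the triangles with vertices among the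
first `n` points of the sequence `p`. The supremum is over a finite set, nonempty for `n ≥ 3`
(for `n < 3` there is no triangle, and the value is `0`). -/
def maxAngle {d : ℕ} (n : ℕ) (p : ℕ → EuclideanSpace ℝ (Fin d)) : ℝ :=
  sSup (triangleMaxAngle p '' (triples n : Set (Finset ℕ)))

/-- `Y_{n,d} = λ_d(K) (n³ / 3!) (π - φ_n)^{d-1}`, as a function of the sequence of points. -/
def angleStat {d : ℕ} (K : Set (EuclideanSpace ℝ (Fin d))) (n : ℕ)
    (p : ℕ → EuclideanSpace ℝ (Fin d)) : ℝ :=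
  elongation K * ((n : ℝ) ^ 3 / (Nat.factorial 3 : ℝ)) * (Real.pi - maxAngle n p) ^ (d - 1)

/-- The standard exponential distribution is a probability measure. -/
instance instIsProbabilityMeasureExpMeasureOne : IsProbabilityMeasure (expMeasure 1) :=
  isProbabilityMeasure_expMeasure one_pos

end

/-!
For `δ > 0`, the event `π - φ_n > δ` says that none of the `n.choose 3` triangles spanned by the
first `n` points is nearly flat, in the sense of having an angle of at least `π - δ`. The
statistic exceeds `a` exactly when this holds for the `δ` with `λ (n ^ 3 / 6) δ ^ (d - 1) = a`, so
the claim is a Poisson limit theorem: nearly flat triangles are rare, triangles without a common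
vertex are independent, and the expected number of flat ones tends to `a`.

*Expected number.* Given the vertices `x`, `y`, the third vertex `z` sees the segment `[x, y]`
under an angle of at least `π - δ` when it lies in a spindle around that segment. In cylindrical
coordinates `(t, h)` along the segment of length `r`, and up to a factor tending to `1`, the
spindle is the lens `r h ≤ δ t (r - t)`, whose volume is a Beta integral
(`volume_lens`, `angleRho_succ`); this gives `tendsto_volume_spindle_div`. For `x`, `y` in an open
convex set the spindle is eventually contained in the set, and
dominated convergence yields the probability of a flat triangle
(`tendsto_integral_uniformLaw_spindle_div`). The passage from `K` to its interior is harmless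
because the frontier of a convex set is null.

*Dependence.* Given two vertices, the third one makes the triangle flat only if it lies in a thin
cylinder around the line through them, so the conditional probability is at most `C δ ^ (d - 1)`
uniformly (`exists_uniformLaw_isFlat_le`). As two distinct triples always differ in a vertex, two
triangles are both flat with probability `O(δ ^ (2 (d - 1)))`
(`integral_flatIndicator_mul_le`).

*Poisson approximation.* For dissociated indicators `I_α`, the function
`q s = 𝔼 ∏ (1 - s I_α)` almost solves `q' = -Λ q`, `Λ = ∑ 𝔼 I_α`, and `q 1` is the probability that
no event occurs (`abs_integral_prod_one_sub_sub_exp_le`). There are `O(n ^ 5)` pairs of triples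
with a common vertex, so the error is `O(n ^ 5 δ ^ (2 (d - 1))) = O(1 / n)`.
-/

/-! ### Poisson approximation for dissociated families of events -/

theorem prod_sub_prod_le_sum {ι : Type*} [DecidableEq ι] {S T : Finset ι} (hST : S ⊆ T)
    {x : ι → ℝ} (h0 : ∀ i ∈ T, 0 ≤ x i) (h1 : ∀ i ∈ T, x i ≤ 1) :
    ∏ i ∈ S, (1 - x i) - ∏ i ∈ T, (1 - x i) ≤ ∑ i ∈ T \ S, x i := by
  have h (R : Finset ι) (hR : R ⊆ T) : 1 - ∑ i ∈ R, x i ≤ ∏ i ∈ R, (1 - x i) := by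
    induction R using Finset.induction_on with
    | empty => simp
    | insert a R ha ih =>
      rw [Finset.sum_insert ha, Finset.prod_insert ha]
      have hRT : R ⊆ T := (Finset.subset_insert a R).trans hR
      have haT : a ∈ T := hR (Finset.mem_insert_self a R)
      have hs : 0 ≤ ∑ i ∈ R, x i := Finset.sum_nonneg fun i hi => h0 i (hRT hi)
      nlinarith [ih hRT, h0 a haT, h1 a haT, mul_le_mul_of_nonneg_left (ih hRT)
        (sub_nonneg.2 (h1 a haT)), mul_nonneg (h0 a haT) hs]
  have hS0 : 0 ≤ ∏ i ∈ S, (1 - x i) :=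
    Finset.prod_nonneg fun i hi => sub_nonneg.2 (h1 i (hST hi))
  have hS1 : ∏ i ∈ S, (1 - x i) ≤ 1 :=
    Finset.prod_le_one (fun i hi => sub_nonneg.2 (h1 i (hST hi)))
      fun i hi => sub_le_self _ (h0 i (hST hi))
  have hsum : 0 ≤ ∑ i ∈ T \ S, x i :=
    Finset.sum_nonneg fun i hi => h0 i (Finset.sdiff_subset hi)
  rw [← Finset.prod_sdiff hST]
  nlinarith [h (T \ S) Finset.sdiff_subset]

section Poisson

variable {Ω ι : Type*} [MeasurableSpace Ω] [DecidableEq ι] {μ : Measure Ω} [IsProbabilityMeasure μ]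

theorem integrable_of_abs_le {f : Ω → ℝ} (hf : Measurable f) {C : ℝ}
    (h : ∀ ω, |f ω| ≤ C) : Integrable f μ :=
  Integrable.of_bound hf.aestronglyMeasurable C (Eventually.of_forall h)

theorem hasDerivAt_integral_prod_one_sub_mul {T : Finset ι} {I : ι → Ω → ℝ}
    (hm : ∀ α ∈ T, Measurable (I α)) (h0 : ∀ α ∈ T, ∀ ω, 0 ≤ I α ω)
    (h1 : ∀ α ∈ T, ∀ ω, I α ω ≤ 1) {s : ℝ} (hs : s ∈ Set.Icc (0 : ℝ) 1) :
    HasDerivAt (fun s => ∫ ω, ∏ α ∈ T, (1 - s * I α ω) ∂μ)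
      (-∑ α ∈ T, ∫ ω, I α ω * ∏ β ∈ T.erase α, (1 - s * I β ω) ∂μ) s := by
  have hfac (s : ℝ) (hs : s ∈ Set.Ioo (-1 : ℝ) 2) (α) (hα : α ∈ T) (ω) :
      |1 - s * I α ω| ≤ 2 := by
    rw [abs_le]
    constructor <;> nlinarith [h0 α hα ω, h1 α hα ω, hs.1, hs.2]
  have hprodm (s : ℝ) (R : Finset ι) (hR : R ⊆ T) :
      Measurable fun ω => ∏ β ∈ R, (1 - s * I β ω) :=
    Finset.measurable_fun_prod _ fun i hi => ((hm i (hR hi)).const_mul s).const_sub 1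
  have hprod (s : ℝ) (hs : s ∈ Set.Ioo (-1 : ℝ) 2) (R : Finset ι) (hR : R ⊆ T) (ω) :
      |∏ β ∈ R, (1 - s * I β ω)| ≤ 2 ^ T.card := by
    rw [Finset.abs_prod]
    calc ∏ β ∈ R, |1 - s * I β ω| ≤ ∏ β ∈ R, (2 : ℝ) :=
          Finset.prod_le_prod (fun _ _ => abs_nonneg _) fun i hi => hfac s hs i (hR hi) ω
      _ = 2 ^ R.card := by simp
      _ ≤ 2 ^ T.card := pow_le_pow_right₀ (by norm_num) (Finset.card_le_card hR)
  have hterm (s : ℝ) (hs : s ∈ Set.Ioo (-1 : ℝ) 2) (α) (hα : α ∈ T) (ω) :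
      |I α ω * ∏ β ∈ T.erase α, (1 - s * I β ω)| ≤ 2 ^ T.card := by
    rw [abs_mul, abs_of_nonneg (h0 α hα ω)]
    calc _ ≤ 1 * |∏ β ∈ T.erase α, (1 - s * I β ω)| :=
          mul_le_mul_of_nonneg_right (h1 α hα ω) (abs_nonneg _)
      _ ≤ _ := by rw [one_mul]; exact hprod s hs _ (Finset.erase_subset _ _) ω
  have htermm (s : ℝ) (α) (hα : α ∈ T) :
      Measurable fun ω => I α ω * ∏ β ∈ T.erase α, (1 - s * I β ω) :=
    (hm α hα).mul (hprodm s _ (Finset.erase_subset _ _))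
  have hs' : s ∈ Set.Ioo (-1 : ℝ) 2 := ⟨by linarith [hs.1], by linarith [hs.2]⟩
  have key := (hasDerivAt_integral_of_dominated_loc_of_deriv_le (μ := μ)
    (F := fun s ω => ∏ α ∈ T, (1 - s * I α ω))
    (F' := fun s ω => -∑ α ∈ T, I α ω * ∏ β ∈ T.erase α, (1 - s * I β ω))
    (bound := fun _ => T.card * (2 : ℝ) ^ T.card)
    (Ioo_mem_nhds hs'.1 hs'.2)
    (Eventually.of_forall fun s => (hprodm s T subset_rfl).aestronglyMeasurable)
    (integrable_of_abs_le (hprodm s T subset_rfl) (hprod s hs' T subset_rfl))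
    (Finset.measurable_fun_sum _ fun α hα => htermm s α hα).neg.aestronglyMeasurable
    (Eventually.of_forall fun ω x hx => by
      rw [norm_neg, Real.norm_eq_abs]
      calc _ ≤ ∑ α ∈ T, |I α ω * ∏ β ∈ T.erase α, (1 - x * I β ω)| :=
            Finset.abs_sum_le_sum_abs _ _
        _ ≤ ∑ α ∈ T, (2 : ℝ) ^ T.card := Finset.sum_le_sum fun α hα => hterm x hx α hα ω
        _ = _ := by simp)
    (integrable_const _)
    (Eventually.of_forall fun ω x _ => by
      have := HasDerivAt.fun_finsetProd (u := T) (x := x) (f := fun α s => 1 - s * I α ω)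
        (f' := fun α => -(I α ω)) fun α _ => by
          simpa using ((hasDerivAt_id x).mul_const (I α ω)).const_sub 1
      refine this.congr_deriv ?_
      rw [← Finset.sum_neg_distrib]
      refine Finset.sum_congr rfl fun α _ => ?_
      simp only [smul_eq_mul]; ring)).2
  refine key.congr_deriv ?_
  rw [integral_neg, integral_finsetSum]
  exact fun α hα => integrable_of_abs_le (htermm s α hα) (hterm s hs' α hα)

/-- **Poisson approximation** for the probability that none of a family of events occurs, when
the event `α` is independent of those outside its neighbourhood `N α`. With
`q s = 𝔼 ∏ (1 - s I_α)` and `Λ = ∑ 𝔼 I_α`, the right-hand side bounds `|q' + Λ q|` on `[0, 1]`,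
hence also `|q 1 - exp (-Λ)|`. -/
theorem abs_integral_prod_one_sub_sub_exp_le {T : Finset ι} {I : ι → Ω → ℝ}
    (hm : ∀ α ∈ T, Measurable (I α)) (h0 : ∀ α ∈ T, ∀ ω, 0 ≤ I α ω)
    (h1 : ∀ α ∈ T, ∀ ω, I α ω ≤ 1) {N : ι → Finset ι}
    (hN : ∀ α ∈ T, α ∈ N α) (hNT : ∀ α ∈ T, N α ⊆ T)
    (hind : ∀ α ∈ T, ∀ s : ℝ,
      IndepFun (I α) (fun ω => ∏ β ∈ T \ N α, (1 - s * I β ω)) μ) :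
    |∫ ω, ∏ α ∈ T, (1 - I α ω) ∂μ - Real.exp (-∑ α ∈ T, ∫ ω, I α ω ∂μ)| ≤
      ∑ α ∈ T, (∑ β ∈ (N α).erase α, ∫ ω, I α ω * I β ω ∂μ +
        (∫ ω, I α ω ∂μ) * ∑ β ∈ N α, ∫ ω, I β ω ∂μ) := by
  set ε := ∑ α ∈ T, (∑ β ∈ (N α).erase α, ∫ ω, I α ω * I β ω ∂μ +
        (∫ ω, I α ω ∂μ) * ∑ β ∈ N α, ∫ ω, I β ω ∂μ) with hε
  set Λ := ∑ α ∈ T, ∫ ω, I α ω ∂μ with hΛ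
  set q : ℝ → ℝ := fun s => ∫ ω, ∏ α ∈ T, (1 - s * I α ω) ∂μ with hq
  set q' : ℝ → ℝ := fun s => -∑ α ∈ T, ∫ ω, I α ω * ∏ β ∈ T.erase α, (1 - s * I β ω) ∂μ with hq'
  have hp0 (α) (hα : α ∈ T) : 0 ≤ ∫ ω, I α ω ∂μ := integral_nonneg (h0 α hα)
  have hΛ0 : 0 ≤ Λ := Finset.sum_nonneg hp0
  have hI (α) (hα : α ∈ T) : Integrable (I α) μ :=
    integrable_of_abs_le (hm α hα) (C := 1) fun ω => by
      rw [abs_of_nonneg (h0 α hα ω)]; exact h1 α hα ω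
  have hII (α) (hα : α ∈ T) (β) (hβ : β ∈ T) : Integrable (fun ω => I α ω * I β ω) μ :=
    integrable_of_abs_le ((hm α hα).mul (hm β hβ)) (C := 1) fun ω => by
      rw [abs_of_nonneg (mul_nonneg (h0 α hα ω) (h0 β hβ ω))]
      exact mul_le_one₀ (h1 α hα ω) (h0 β hβ ω) (h1 β hβ ω)
  have hε0 : 0 ≤ ε := by
    refine Finset.sum_nonneg fun α hα => add_nonneg (Finset.sum_nonneg fun β hβ =>
      integral_nonneg fun ω => mul_nonneg (h0 α hα ω)
        (h0 β (hNT α hα (Finset.mem_of_mem_erase hβ)) ω)) ?_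
    exact mul_nonneg (hp0 α hα) (Finset.sum_nonneg fun β hβ => hp0 β (hNT α hα hβ))
  -- the differential inequality `|q' + Λ q| ≤ ε`
  have hode (s : ℝ) (hs : s ∈ Set.Icc (0 : ℝ) 1) : |q' s + Λ * q s| ≤ ε := by
    have hsI0 (α) (hα : α ∈ T) (ω) : 0 ≤ s * I α ω := mul_nonneg hs.1 (h0 α hα ω)
    have hsI (α) (hα : α ∈ T) (ω) : s * I α ω ≤ I α ω :=
      mul_le_of_le_one_left (h0 α hα ω) hs.2
    have hsI1 (α) (hα : α ∈ T) (ω) : s * I α ω ≤ 1 := (hsI α hα ω).trans (h1 α hα ω)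
    have hdiff {R S : Finset ι} (hRS : R ⊆ S) (hS : S ⊆ T) (ω) :
        ∏ β ∈ R, (1 - s * I β ω) - ∏ β ∈ S, (1 - s * I β ω) ≤ ∑ β ∈ S \ R, I β ω :=
      (prod_sub_prod_le_sum hRS (fun i hi => hsI0 i (hS hi) ω)
        fun i hi => hsI1 i (hS hi) ω).trans
        (Finset.sum_le_sum fun i hi => hsI i (hS (Finset.sdiff_subset hi)) ω)
    have hmono {R S : Finset ι} (hRS : R ⊆ S) (hS : S ⊆ T) (ω) :
        ∏ β ∈ S, (1 - s * I β ω) ≤ ∏ β ∈ R, (1 - s * I β ω) :=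
      Finset.prod_le_prod_of_subset_of_le_one hRS (fun i hi => sub_nonneg.2 (hsI1 i (hS hi) ω))
        fun i hi _ => sub_le_self _ (hsI0 i (hS hi) ω)
    have hpm (R : Finset ι) (hR : R ⊆ T) : Measurable fun ω => ∏ β ∈ R, (1 - s * I β ω) :=
      Finset.measurable_fun_prod _ fun i hi => ((hm i (hR hi)).const_mul s).const_sub 1
    have hp0' (R : Finset ι) (hR : R ⊆ T) (ω) : 0 ≤ ∏ β ∈ R, (1 - s * I β ω) :=
      Finset.prod_nonneg fun i hi => sub_nonneg.2 (hsI1 i (hR hi) ω)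
    have hp1' (R : Finset ι) (hR : R ⊆ T) (ω) : ∏ β ∈ R, (1 - s * I β ω) ≤ 1 :=
      Finset.prod_le_one (fun i hi => sub_nonneg.2 (hsI1 i (hR hi) ω))
        fun i hi => sub_le_self _ (hsI0 i (hR hi) ω)
    have hpi (R : Finset ι) (hR : R ⊆ T) :
        Integrable (fun ω => ∏ β ∈ R, (1 - s * I β ω)) μ :=
      integrable_of_abs_le (hpm R hR) (C := 1) fun ω => by
        rw [abs_of_nonneg (hp0' R hR ω)]; exact hp1' R hR ω
    have hIpi (α) (hα : α ∈ T) (R : Finset ι) (hR : R ⊆ T) :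
        Integrable (fun ω => I α ω * ∏ β ∈ R, (1 - s * I β ω)) μ :=
      integrable_of_abs_le ((hm α hα).mul (hpm R hR)) (C := 1) fun ω => by
        rw [abs_of_nonneg (mul_nonneg (h0 α hα ω) (hp0' R hR ω))]
        exact mul_le_one₀ (h1 α hα ω) (hp0' R hR ω) (hp1' R hR ω)
    have hsplit : q' s + Λ * q s = ∑ α ∈ T, ((∫ ω, I α ω ∂μ) * q s -
        ∫ ω, I α ω * ∏ β ∈ T.erase α, (1 - s * I β ω) ∂μ) := by
      rw [Finset.sum_sub_distrib, ← Finset.sum_mul]; simp only [hq', hΛ]; ring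
    rw [hsplit]
    refine (Finset.abs_sum_le_sum_abs _ _).trans (Finset.sum_le_sum fun α hα => ?_)
    have hVT : T \ N α ⊆ T := Finset.sdiff_subset
    have hVe : T \ N α ⊆ T.erase α := fun β hβ =>
      Finset.mem_erase.2 ⟨fun h => (Finset.mem_sdiff.1 hβ).2 (h ▸ hN α hα), hVT hβ⟩
    have heT : T.erase α ⊆ T := Finset.erase_subset _ _
    have hindep := (hind α hα s).integral_fun_mul_eq_mul_integral
      (hm α hα).aestronglyMeasurable (hpm _ hVT).aestronglyMeasurable
    have hd1 : T.erase α \ (T \ N α) = (N α).erase α := by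
      ext β; simp only [Finset.mem_sdiff, Finset.mem_erase]
      have := @hNT α hα β; tauto
    have hd2 : T \ (T \ N α) = N α := by
      rw [Finset.sdiff_sdiff_eq_self (hNT α hα)]
    have e1 : ∫ ω, I α ω * ∏ β ∈ T \ N α, (1 - s * I β ω) ∂μ -
        ∫ ω, I α ω * ∏ β ∈ T.erase α, (1 - s * I β ω) ∂μ ≤
        ∑ β ∈ (N α).erase α, ∫ ω, I α ω * I β ω ∂μ := by
      rw [← integral_sub (hIpi α hα _ hVT) (hIpi α hα _ heT), ← integral_finsetSum _ fun β hβ =>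
        hII α hα β (hNT α hα (Finset.mem_of_mem_erase hβ))]
      refine integral_mono ((hIpi α hα _ hVT).sub (hIpi α hα _ heT))
        (integrable_finsetSum _ fun β hβ =>
          hII α hα β (hNT α hα (Finset.mem_of_mem_erase hβ))) fun ω => ?_
      have := hdiff hVe heT ω
      rw [hd1] at this
      simp only [← mul_sub, ← Finset.mul_sum]
      exact mul_le_mul_of_nonneg_left this (h0 α hα ω)
    have e1' : ∫ ω, I α ω * ∏ β ∈ T.erase α, (1 - s * I β ω) ∂μ ≤
        ∫ ω, I α ω * ∏ β ∈ T \ N α, (1 - s * I β ω) ∂μ :=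
      integral_mono (hIpi α hα _ heT) (hIpi α hα _ hVT) fun ω =>
        mul_le_mul_of_nonneg_left (hmono hVe heT ω) (h0 α hα ω)
    have e2 : ∫ ω, ∏ β ∈ T \ N α, (1 - s * I β ω) ∂μ - q s ≤ ∑ β ∈ N α, ∫ ω, I β ω ∂μ := by
      rw [hq, ← integral_sub (hpi _ hVT) (hpi _ subset_rfl), ← integral_finsetSum _ fun β hβ =>
        hI β (hNT α hα hβ)]
      refine integral_mono ((hpi _ hVT).sub (hpi _ subset_rfl))
        (integrable_finsetSum _ fun β hβ => hI β (hNT α hα hβ)) fun ω => ?_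
      have := hdiff hVT subset_rfl ω
      rwa [hd2] at this
    have e2' : q s ≤ ∫ ω, ∏ β ∈ T \ N α, (1 - s * I β ω) ∂μ :=
      integral_mono (hpi _ subset_rfl) (hpi _ hVT) fun ω => hmono hVT subset_rfl ω
    have e3 := mul_le_mul_of_nonneg_left e2 (hp0 α hα)
    have e3' := mul_le_mul_of_nonneg_left e2' (hp0 α hα)
    rw [hindep] at e1 e1'
    rw [abs_le]
    constructor <;> nlinarith
  -- integrate it with the integrating factor `exp (Λ s)`
  have hder (s : ℝ) (hs : s ∈ Set.Icc (0 : ℝ) 1) :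
      HasDerivWithinAt (fun s => Real.exp (Λ * s) * q s)
        (Real.exp (Λ * s) * (q' s + Λ * q s)) (Set.Icc 0 1) s := by
    have h2 := hasDerivAt_integral_prod_one_sub_mul (μ := μ) hm h0 h1 hs
    have h3 := (((hasDerivAt_id s).const_mul Λ).exp).mul h2
    refine HasDerivAt.hasDerivWithinAt ?_
    refine h3.congr_deriv ?_
    simp only [hq', hq, id, mul_one]; ring
  have hbound (s : ℝ) (hs : s ∈ Set.Icc (0 : ℝ) 1) :
      ‖Real.exp (Λ * s) * (q' s + Λ * q s)‖ ≤ Real.exp Λ * ε := by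
    rw [norm_mul, Real.norm_eq_abs, Real.norm_eq_abs, Real.abs_exp]
    exact mul_le_mul (Real.exp_le_exp.2 (mul_le_of_le_one_right hΛ0 hs.2)) (hode s hs)
      (abs_nonneg _) (Real.exp_pos _).le
  have hfin := Convex.norm_image_sub_le_of_norm_hasDerivWithin_le hder hbound
    (convex_Icc (0 : ℝ) 1) (Set.left_mem_Icc.2 zero_le_one) (Set.right_mem_Icc.2 zero_le_one)
  have hq0 : q 0 = 1 := by simp [hq]
  have hq1 : q 1 = ∫ ω, ∏ α ∈ T, (1 - I α ω) ∂μ := by simp [hq]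
  rw [hq0, mul_zero, Real.exp_zero, mul_one, mul_one, sub_zero, norm_one, mul_one,
    Real.norm_eq_abs] at hfin
  rw [← hq1]
  have hE := Real.exp_pos Λ
  have : |q 1 - Real.exp (-Λ)| * Real.exp Λ = |Real.exp Λ * q 1 - 1| := by
    rw [← abs_of_pos hE, ← abs_mul, abs_of_pos hE, sub_mul, ← Real.exp_add]
    simp [mul_comm]
  nlinarith

end Poisson

/-! ### Orthogonal coordinates along a line -/

theorem exists_measurePreserving_coords {m : ℕ} (u : EuclideanSpace ℝ (Fin (m + 1)))
    (hu : ‖u‖ = 1) :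
    ∃ Φ : EuclideanSpace ℝ (Fin (m + 1)) → ℝ × EuclideanSpace ℝ (Fin m),
      MeasurePreserving Φ ∧ (∀ z, (Φ z).1 = inner ℝ u z) ∧
        ∀ z, ‖z‖ ^ 2 = (Φ z).1 ^ 2 + ‖(Φ z).2‖ ^ 2 := by
  obtain ⟨b, hb⟩ := Orthonormal.exists_orthonormalBasis_extension_of_card_eq (𝕜 := ℝ)
    (E := EuclideanSpace ℝ (Fin (m + 1))) (ι := Fin (m + 1)) (by simp)
    (v := fun _ => u) (s := {0}) (by
      refine ⟨fun i => by simpa using hu, fun i j hij => (hij (Subsingleton.elim i j)).elim⟩)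
  have hb0 : b 0 = u := hb 0 rfl
  refine ⟨fun z => (b.repr z 0, WithLp.toLp 2 fun i => b.repr z i.succ), ?_, ?_, ?_⟩
  · have h1 := b.measurePreserving_repr
    have h2 := EuclideanSpace.volume_preserving_symm_measurableEquiv_toLp (Fin (m + 1))
    have h3 := volume_preserving_piFinSuccAbove (fun _ : Fin (m + 1) => ℝ) 0
    have h4 := (MeasurePreserving.id (volume : Measure ℝ)).prod
      (EuclideanSpace.volume_preserving_symm_measurableEquiv_toLp (Fin m)).symm
    exact h4.comp (h3.comp (h2.comp h1))
  · intro z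
    simp only [b.repr_apply_apply, hb0]
  · intro z
    rw [← b.repr.norm_map z, EuclideanSpace.real_norm_sq_eq, EuclideanSpace.real_norm_sq_eq,
      Fin.sum_univ_succ]

/-! ### The volume of a thin parabolic lens -/

/-- The solid of revolution around the segment `[0, r]` of the first axis, whose radius at
height `t` is `c t (r - t) / r`. -/
def lens (m : ℕ) (c r : ℝ) : Set (ℝ × EuclideanSpace ℝ (Fin m)) :=
  {p | p.1 ∈ Set.Ioo 0 r ∧ r * ‖p.2‖ ≤ c * (p.1 * (r - p.1))}

theorem measurableSet_lens (m : ℕ) (c r : ℝ) : MeasurableSet (lens m c r) := by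
  have h : MeasurableSet {p : ℝ × EuclideanSpace ℝ (Fin m) |
      r * ‖p.2‖ ≤ c * (p.1 * (r - p.1))} := measurableSet_le (by fun_prop) (by fun_prop)
  exact (measurable_fst measurableSet_Ioo).inter h

theorem integral_mul_sub_pow (m : ℕ) {r : ℝ} (hr : 0 < r) :
    ∫ t in (0)..r, (t * (r - t)) ^ m =
      r ^ (2 * m + 1) * (Real.Gamma (m + 1) ^ 2 / Real.Gamma (2 * (m + 1))) := by
  have h := Complex.betaIntegral_scaled ((m : ℂ) + 1) (m + 1) hr
  rw [Complex.betaIntegral_eq_Gamma_mul_div _ _ (by simp; positivity) (by simp; positivity)] at h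
  have e : (m : ℂ) + 1 + (m + 1) - 1 = ((2 * m + 1 : ℕ) : ℂ) := by push_cast; ring
  have e2 : (m : ℂ) + 1 + (m + 1) = ((2 * (m + 1) : ℝ) : ℂ) := by push_cast; ring
  have e1 : (m : ℂ) + 1 = ((m + 1 : ℝ) : ℂ) := by push_cast; ring
  simp only [add_sub_cancel_right, Complex.cpow_natCast] at h
  rw [e, Complex.cpow_natCast, e2, e1, Complex.Gamma_ofReal, Complex.Gamma_ofReal] at h
  rw [← Complex.ofReal_inj, ← intervalIntegral.integral_ofReal]
  push_cast
  simp only [mul_pow]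
  rw [h]
  ring

/-- The constant `ρ_{m+1}` is the volume of the unit ball of `ℝ^m` times `B(m + 1, m + 1)`;
this is the duplication formula for the Gamma function. -/
theorem angleRho_succ (m : ℕ) :
    angleRho (m + 1) = √Real.pi ^ m / Real.Gamma ((m : ℝ) / 2 + 1) *
      (Real.Gamma (m + 1) ^ 2 / Real.Gamma (2 * (m + 1))) := by
  have hd := Real.Gamma_mul_Gamma_add_half ((m : ℝ) + 1)
  have g1 : 0 < Real.Gamma ((m : ℝ) + 1) := Real.Gamma_pos_of_pos (by positivity)
  have g2 : 0 < Real.Gamma ((m : ℝ) / 2 + 1) := Real.Gamma_pos_of_pos (by positivity)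
  have g3 : 0 < Real.Gamma (2 * ((m : ℝ) + 1)) := Real.Gamma_pos_of_pos (by positivity)
  have g4 : 0 < Real.Gamma ((m : ℝ) + 1 + 1 / 2) := Real.Gamma_pos_of_pos (by positivity)
  have e1 : Real.pi ^ (((m + 1 : ℕ) : ℝ) / 2) = √Real.pi ^ (m + 1) := by
    rw [Real.sqrt_eq_rpow, ← Real.rpow_natCast, ← Real.rpow_mul Real.pi_pos.le]
    congr 1; ring
  have e2 : (2 : ℝ) ^ (1 - 2 * ((m : ℝ) + 1)) = (2 ^ (2 * m + 1))⁻¹ := by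
    rw [← Real.rpow_natCast, ← Real.rpow_neg (by norm_num)]
    congr 1; push_cast; ring
  have e3 : (((m + 1 : ℕ) : ℝ) + 1) / 2 = (m : ℝ) / 2 + 1 := by push_cast; ring
  have e4 : 2 * (m + 1) - 1 = 2 * m + 1 := by omega
  rw [angleRho, e1, e3, e4]
  rw [e2] at hd
  push_cast
  rw [div_mul_div_comm, div_eq_div_iff (by positivity) (by positivity)]
  have hd' : Real.Gamma ((m : ℝ) + 1) * Real.Gamma ((m : ℝ) + 1 + 1 / 2) * 2 ^ (2 * m + 1) =
      Real.Gamma (2 * ((m : ℝ) + 1)) * √Real.pi := by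
    rw [hd]; field_simp
  rw [pow_succ (√Real.pi) m]
  linear_combination (-(√Real.pi ^ m * Real.Gamma ((m : ℝ) + 1) * Real.Gamma ((m : ℝ) / 2 + 1))) * hd'

theorem angleRho_succ_pos (m : ℕ) : 0 < angleRho (m + 1) := by
  rw [angleRho_succ]
  have g1 : 0 < Real.Gamma ((m : ℝ) + 1) := Real.Gamma_pos_of_pos (by positivity)
  have g2 : 0 < Real.Gamma ((m : ℝ) / 2 + 1) := Real.Gamma_pos_of_pos (by positivity)
  have g3 : 0 < Real.Gamma (2 * ((m : ℝ) + 1)) := Real.Gamma_pos_of_pos (by positivity)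
  positivity

theorem volume_lens {m : ℕ} (hm : 0 < m) {c r : ℝ} (hc : 0 ≤ c) (hr : 0 < r) :
    volume (lens m c r) = ENNReal.ofReal (c ^ m * (angleRho (m + 1) * r ^ (m + 1))) := by
  have : Nonempty (Fin m) := ⟨⟨0, hm⟩⟩
  have g2 : 0 < Real.Gamma ((m : ℝ) / 2 + 1) := Real.Gamma_pos_of_pos (by positivity)
  set κ : ℝ := √Real.pi ^ m / Real.Gamma ((m : ℝ) / 2 + 1) with hκ
  have hκ0 : 0 ≤ κ := by positivity
  rw [Measure.volume_eq_prod, Measure.prod_apply (measurableSet_lens m c r)]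
  have hsec (t : ℝ) : volume (Prod.mk t ⁻¹' lens m c r) =
      (Set.Ioo 0 r).indicator
        (fun t => ENNReal.ofReal (κ * (c / r) ^ m * (t * (r - t)) ^ m)) t := by
    by_cases ht : t ∈ Set.Ioo 0 r
    · rw [Set.indicator_of_mem ht]
      have : Prod.mk t ⁻¹' lens m c r =
          Metric.closedBall (0 : EuclideanSpace ℝ (Fin m)) (c / r * (t * (r - t))) := by
        ext w
        simp only [lens, Set.mem_preimage, Set.mem_ofPred_eq, ht, true_and, mem_closedBall_zero_iff]
        rw [div_mul_eq_mul_div, le_div_iff₀ hr, mul_comm r]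
      have h0 : 0 ≤ c / r * (t * (r - t)) :=
        mul_nonneg (div_nonneg hc hr.le) (mul_nonneg ht.1.le (sub_nonneg.2 ht.2.le))
      rw [this, EuclideanSpace.volume_closedBall, Fintype.card_fin, ← ENNReal.ofReal_pow h0,
        ← ENNReal.ofReal_mul (pow_nonneg h0 m)]
      congr 1; rw [mul_pow]; ring
    · rw [Set.indicator_of_notMem ht]
      have : Prod.mk t ⁻¹' lens m c r = ∅ := by
        ext w
        simp only [lens, Set.mem_preimage, Set.mem_ofPred_eq, ht, false_and,
          Set.mem_empty_iff_false]
      rw [this, measure_empty]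
  simp_rw [hsec]
  rw [lintegral_indicator measurableSet_Ioo, ← ofReal_integral_eq_lintegral_ofReal]
  · congr 1
    rw [← integral_Ioc_eq_integral_Ioo, ← intervalIntegral.integral_of_le hr.le,
      intervalIntegral.integral_const_mul, integral_mul_sub_pow m hr, angleRho_succ, ← hκ,
      div_pow]
    field_simp
    ring
  · refine (Continuous.integrableOn_Icc (a := 0) (b := r) (by fun_prop)).mono_set
      Set.Ioo_subset_Icc_self
  · filter_upwards [ae_restrict_mem measurableSet_Ioo] with t ht
    have : 0 ≤ t * (r - t) := mul_nonneg ht.1.le (sub_nonneg.2 ht.2.le)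
    have : 0 ≤ c / r := div_nonneg hc hr.le
    positivity

/-! ### Points that see a segment under an angle close to `π` -/

theorem pi_sub_le_angle_iff {V : Type*} [NormedAddCommGroup V] [InnerProductSpace ℝ V]
    {δ : ℝ} (h0 : 0 < δ) (h1 : δ < Real.pi / 2) (a b : V) :
    Real.pi - δ ≤ InnerProductGeometry.angle a b ↔
      0 < -inner ℝ a b ∧
        √(inner ℝ a a * inner ℝ b b - inner ℝ a b * inner ℝ a b) * Real.cos δ ≤
          Real.sin δ * (-inner ℝ a b) := by
  set θ := InnerProductGeometry.angle a b with hθ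
  have hc := InnerProductGeometry.cos_angle_mul_norm_mul_norm a b
  have hs := InnerProductGeometry.sin_angle_mul_norm_mul_norm a b
  have hθ0 := InnerProductGeometry.angle_nonneg a b
  have hθπ := InnerProductGeometry.angle_le_pi a b
  rw [← hθ] at hc hs hθ0 hθπ
  rw [← hs, ← hc]
  have hA0 : 0 ≤ ‖a‖ * ‖b‖ := by positivity
  have hsin : Real.sin (δ + θ - Real.pi) =
      Real.sin δ * (-Real.cos θ) - Real.sin θ * Real.cos δ := by
    rw [Real.sin_sub_pi, Real.sin_add]; ring
  have hcδ : 0 < Real.cos δ := Real.cos_pos_of_mem_Ioo ⟨by linarith, h1⟩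
  constructor
  · intro h
    have hcos : Real.cos θ < 0 := Real.cos_neg_of_pi_div_two_lt_of_lt (by linarith) (by linarith)
    have hA : 0 < ‖a‖ * ‖b‖ := by
      refine hA0.lt_of_ne' fun hA => ?_
      have : θ = Real.pi / 2 := by
        rcases mul_eq_zero.1 hA with h | h
        · rw [norm_eq_zero] at h; rw [hθ, h, InnerProductGeometry.angle_zero_left]
        · rw [norm_eq_zero] at h; rw [hθ, h, InnerProductGeometry.angle_zero_right]
      linarith
    have : 0 ≤ Real.sin (δ + θ - Real.pi) :=
      Real.sin_nonneg_of_nonneg_of_le_pi (by linarith) (by linarith)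
    rw [hsin] at this
    constructor <;> nlinarith
  · rintro ⟨h2, h3⟩
    have hA : 0 < ‖a‖ * ‖b‖ := by
      refine hA0.lt_of_ne' fun hA => ?_
      rw [hA] at h2; simp at h2
    by_contra! hlt
    have : Real.sin (δ + θ - Real.pi) < 0 :=
      Real.sin_neg_of_neg_of_neg_pi_lt (by linarith) (by linarith)
    rw [hsin] at this
    nlinarith

/-- The set of points from which the segment `[x, y]` is seen under an angle at least `π - δ`. -/
def spindle {m : ℕ} (δ : ℝ) (x y : EuclideanSpace ℝ (Fin m)) : Set (EuclideanSpace ℝ (Fin m)) :=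
  {z | Real.pi - δ ≤ ∠ x z y}

section Coordinates

variable {m : ℕ} {x y : EuclideanSpace ℝ (Fin (m + 1))}
  {Φ : EuclideanSpace ℝ (Fin (m + 1)) → ℝ × EuclideanSpace ℝ (Fin m)}

theorem mem_spindle_iff {δ : ℝ} (h0 : 0 < δ) (h1 : δ < Real.pi / 2) (hxy : x ≠ y)
    (hΦ1 : ∀ z, (Φ z).1 = inner ℝ (‖y - x‖⁻¹ • (y - x)) z)
    (hΦ2 : ∀ z, ‖z‖ ^ 2 = (Φ z).1 ^ 2 + ‖(Φ z).2‖ ^ 2) (z) :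
    z ∈ spindle δ x y ↔
      0 < (Φ (z - x)).1 * (‖y - x‖ - (Φ (z - x)).1) - ‖(Φ (z - x)).2‖ ^ 2 ∧
        ‖y - x‖ * ‖(Φ (z - x)).2‖ * Real.cos δ ≤
          Real.sin δ * ((Φ (z - x)).1 * (‖y - x‖ - (Φ (z - x)).1) - ‖(Φ (z - x)).2‖ ^ 2) := by
  have hr : 0 < ‖y - x‖ := norm_pos_iff.2 (sub_ne_zero.2 hxy.symm)
  set r := ‖y - x‖ with hr_def
  set v := z - x with hv
  set t := (Φ v).1 with ht
  set h := ‖(Φ v).2‖ with hh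
  have hh0 : 0 ≤ h := norm_nonneg _
  have ha : x - z = -v := by rw [hv]; abel
  have hb : y - z = (y - x) - v := by rw [hv]; abel
  have hin : inner ℝ (y - x) v = r * t := by
    rw [ht, hΦ1, real_inner_smul_left]; field_simp
  have hvv : inner ℝ v v = t ^ 2 + h ^ 2 := by
    rw [real_inner_self_eq_norm_sq, hΦ2]
  have hrr : inner ℝ (y - x) (y - x) = r ^ 2 := real_inner_self_eq_norm_sq _
  have e1 : -inner ℝ (x - z) (y - z) = t * (r - t) - h ^ 2 := by
    rw [ha, hb, inner_neg_left, neg_neg, inner_sub_right, real_inner_comm, hin, hvv]; ring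
  have e2 : inner ℝ (x - z) (x - z) = t ^ 2 + h ^ 2 := by
    rw [ha, inner_neg_neg, hvv]
  have e3 : inner ℝ (y - z) (y - z) = (r - t) ^ 2 + h ^ 2 := by
    rw [hb, inner_sub_left, inner_sub_right _ (y - x) v, inner_sub_right _ (y - x) v,
      real_inner_comm (y - x) v, hin, hvv, hrr]; ring
  have e4 : √(inner ℝ (x - z) (x - z) * inner ℝ (y - z) (y - z) -
      inner ℝ (x - z) (y - z) * inner ℝ (x - z) (y - z)) = r * h := by
    rw [← Real.sqrt_sq (mul_nonneg hr.le hh0)]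
    congr 1
    have e1' : inner ℝ (x - z) (y - z) = -(t * (r - t) - h ^ 2) := by linarith
    rw [e1', e2, e3]; ring
  have := pi_sub_le_angle_iff h0 h1 (x - z) (y - z)
  rw [e1, e4] at this
  exact this

theorem spindle_subset_lens {δ : ℝ} (h0 : 0 < δ) (h1 : δ < Real.pi / 2) (hxy : x ≠ y)
    (hΦ1 : ∀ z, (Φ z).1 = inner ℝ (‖y - x‖⁻¹ • (y - x)) z)
    (hΦ2 : ∀ z, ‖z‖ ^ 2 = (Φ z).1 ^ 2 + ‖(Φ z).2‖ ^ 2) :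
    spindle δ x y ⊆ (fun z => Φ (z - x)) ⁻¹' lens m (Real.tan δ) ‖y - x‖ := by
  intro z hz
  rw [mem_spindle_iff h0 h1 hxy hΦ1 hΦ2] at hz
  have hr : 0 < ‖y - x‖ := norm_pos_iff.2 (sub_ne_zero.2 hxy.symm)
  have hcδ : 0 < Real.cos δ := Real.cos_pos_of_mem_Ioo ⟨by linarith, h1⟩
  have hsδ : 0 < Real.sin δ := Real.sin_pos_of_pos_of_lt_pi h0 (by linarith [Real.pi_pos])
  simp only [lens, Set.mem_preimage, Set.mem_ofPred_eq, Set.mem_Ioo]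
  obtain ⟨h2, h3⟩ := hz
  have hpos : 0 < (Φ (z - x)).1 * (‖y - x‖ - (Φ (z - x)).1) := by
    linarith [sq_nonneg ‖(Φ (z - x)).2‖]
  refine ⟨?_, ?_⟩
  · rcases mul_pos_iff.1 hpos with h | h
    · exact ⟨h.1, by linarith [h.2]⟩
    · exfalso; linarith [h.1, h.2]
  · rw [Real.tan_eq_sin_div_cos, div_mul_eq_mul_div, le_div_iff₀ hcδ]
    nlinarith [sq_nonneg ‖(Φ (z - x)).2‖]

/-- The narrower lens inside the spindle: for `r h ≤ c t (r - t)` with `c ≤ tan δ`, the quadratic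
term `h ^ 2` is at most `tan δ ^ 2 t (r - t) / 4`, because `t (r - t) ≤ r ^ 2 / 4`. -/
theorem lens_subset_spindle {δ : ℝ} (h0 : 0 < δ) (h1 : δ < Real.pi / 2)
    (h4 : Real.tan δ ^ 2 < 4) (hxy : x ≠ y)
    (hΦ1 : ∀ z, (Φ z).1 = inner ℝ (‖y - x‖⁻¹ • (y - x)) z)
    (hΦ2 : ∀ z, ‖z‖ ^ 2 = (Φ z).1 ^ 2 + ‖(Φ z).2‖ ^ 2) :
    (fun z => Φ (z - x)) ⁻¹' lens m (Real.tan δ * (1 - Real.tan δ ^ 2 / 4)) ‖y - x‖ ⊆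
      spindle δ x y := by
  intro z hz
  rw [mem_spindle_iff h0 h1 hxy hΦ1 hΦ2]
  have hr : 0 < ‖y - x‖ := norm_pos_iff.2 (sub_ne_zero.2 hxy.symm)
  have hcδ : 0 < Real.cos δ := Real.cos_pos_of_mem_Ioo ⟨by linarith, h1⟩
  have htδ : 0 < Real.tan δ := Real.tan_pos_of_pos_of_lt_pi_div_two h0 h1
  have hsin : Real.sin δ = Real.tan δ * Real.cos δ := (Real.tan_mul_cos hcδ.ne').symm
  simp only [lens, Set.mem_preimage, Set.mem_ofPred_eq, Set.mem_Ioo] at hz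
  obtain ⟨⟨ht0, htr⟩, hz⟩ := hz
  set r := ‖y - x‖
  set t := (Φ (z - x)).1
  set h := ‖(Φ (z - x)).2‖
  set τ := Real.tan δ
  have hh0 : 0 ≤ h := norm_nonneg _
  set S := t * (r - t) with hS
  have hS0 : 0 < S := mul_pos ht0 (sub_pos.2 htr)
  have hSr : 4 * S ≤ r ^ 2 := by nlinarith [sq_nonneg (r - 2 * t)]
  have h5 : r * h ≤ τ * S := by
    refine hz.trans ?_
    have : 0 ≤ τ * S * (τ ^ 2 / 4) := by positivity
    linarith
  have h6 : (r * h) ^ 2 ≤ (τ * S) ^ 2 := pow_le_pow_left₀ (by positivity) h5 2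
  -- `h ^ 2 ≤ τ ^ 2 S / 4`
  have h7 : h ^ 2 ≤ τ ^ 2 / 4 * S := by
    have h8 : r ^ 2 * h ^ 2 ≤ r ^ 2 * (τ ^ 2 / 4 * S) := by
      calc r ^ 2 * h ^ 2 = (r * h) ^ 2 := by ring
        _ ≤ (τ * S) ^ 2 := h6
        _ = τ ^ 2 / 4 * S * (4 * S) := by ring
        _ ≤ τ ^ 2 / 4 * S * r ^ 2 := mul_le_mul_of_nonneg_left hSr (by positivity)
        _ = _ := by ring
    exact le_of_mul_le_mul_left h8 (by positivity)
  refine ⟨by nlinarith, ?_⟩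
  rw [hsin, show τ * Real.cos δ * (S - h ^ 2) = τ * (S - h ^ 2) * Real.cos δ by ring]
  refine mul_le_mul_of_nonneg_right (hz.trans ?_) hcδ.le
  rw [mul_assoc]
  exact mul_le_mul_of_nonneg_left (by linarith) htδ.le

end Coordinates

theorem volume_preimage_lens {m : ℕ} (hm : 0 < m) {c r : ℝ} (hc : 0 ≤ c) (hr : 0 < r)
    {Φ : EuclideanSpace ℝ (Fin (m + 1)) → ℝ × EuclideanSpace ℝ (Fin m)}
    (hΦ : MeasurePreserving Φ) (x : EuclideanSpace ℝ (Fin (m + 1))) :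
    volume.real ((fun z => Φ (z - x)) ⁻¹' lens m c r) =
      c ^ m * (angleRho (m + 1) * r ^ (m + 1)) := by
  have h := (hΦ.comp (measurePreserving_sub_right volume x)).measure_preimage
    (measurableSet_lens m c r).nullMeasurableSet
  rw [volume_lens hm hc hr] at h
  have h0 : 0 ≤ c ^ m * (angleRho (m + 1) * r ^ (m + 1)) :=
    mul_nonneg (pow_nonneg hc m) (mul_nonneg (angleRho_succ_pos m).le (pow_nonneg hr.le _))
  rw [measureReal_def, ← ENNReal.toReal_ofReal h0, ← h]
  rfl

theorem norm_inv_norm_smul_sub {m : ℕ} {x y : EuclideanSpace ℝ (Fin m)} (hxy : x ≠ y) :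
    ‖‖y - x‖⁻¹ • (y - x)‖ = 1 := by
  have hr : 0 < ‖y - x‖ := norm_pos_iff.2 (sub_ne_zero.2 hxy.symm)
  rw [norm_smul, norm_inv, norm_norm, inv_mul_cancel₀ hr.ne']

theorem spindle_self {m : ℕ} {δ : ℝ} (h1 : δ < Real.pi / 2) (x : EuclideanSpace ℝ (Fin m)) :
    spindle δ x x = ∅ := by
  ext z
  simp only [spindle, Set.mem_ofPred_eq, Set.mem_empty_iff_false, iff_false, not_le]
  by_cases hz : x = z
  · subst hz; rw [EuclideanGeometry.angle_self_left]; linarith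
  · rw [EuclideanGeometry.angle_self_of_ne hz]; linarith [Real.pi_pos]

theorem tendsto_tan_div_nhdsGT_zero :
    Tendsto (fun δ : ℝ => Real.tan δ / δ) (𝓝[>] 0) (𝓝 1) := by
  have h : HasDerivAt Real.tan 1 0 := by
    have := Real.hasDerivAt_tan (x := 0) (by simp)
    simpa using this
  have h2 := (hasDerivAt_iff_tendsto_slope.1 h).mono_left
    (nhdsWithin_mono 0 (fun x (hx : 0 < x) => hx.ne'))
  refine h2.congr fun δ => ?_
  simp [slope_def_field]

theorem tendsto_tan_nhdsGT_zero : Tendsto Real.tan (𝓝[>] 0) (𝓝 0) := by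
  have h : ContinuousAt Real.tan 0 := Real.continuousAt_tan.2 (by simp)
  simpa using h.tendsto.mono_left nhdsWithin_le_nhds

theorem eventually_lt_nhdsGT_zero {c : ℝ} (hc : 0 < c) : ∀ᶠ δ : ℝ in 𝓝[>] 0, 0 < δ ∧ δ < c := by
  filter_upwards [Ioo_mem_nhdsGT hc] with δ hδ using hδ

/-- The volume of the set of points seeing `[x, y]` under an angle at least `π - δ` is
asymptotic to `ρ ‖x - y‖ ^ d * δ ^ (d - 1)`. -/
theorem tendsto_volume_spindle_div {m : ℕ} (hm : 0 < m) (x y : EuclideanSpace ℝ (Fin (m + 1))) :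
    Tendsto (fun δ => volume.real (spindle δ x y) / δ ^ m) (𝓝[>] 0)
      (𝓝 (angleRho (m + 1) * ‖x - y‖ ^ (m + 1))) := by
  by_cases hxy : x = y
  · subst hxy
    rw [sub_self, norm_zero, zero_pow (by omega), mul_zero]
    refine tendsto_const_nhds.congr' ?_
    filter_upwards [eventually_lt_nhdsGT_zero (half_pos Real.pi_pos)] with δ hδ
    rw [spindle_self hδ.2]; simp
  obtain ⟨Φ, hΦ, hΦ1, hΦ2⟩ := exists_measurePreserving_coords _ (norm_inv_norm_smul_sub hxy)
  have hr : 0 < ‖y - x‖ := norm_pos_iff.2 (sub_ne_zero.2 (Ne.symm hxy))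
  rw [norm_sub_rev x y]
  set V := angleRho (m + 1) * ‖y - x‖ ^ (m + 1) with hV
  have htan2 : ∀ᶠ δ : ℝ in 𝓝[>] 0, Real.tan δ ^ 2 < 4 := by
    have := tendsto_tan_nhdsGT_zero.pow 2
    exact this.eventually (gt_mem_nhds (by norm_num))
  have hup : Tendsto (fun δ : ℝ => (Real.tan δ / δ) ^ m * V) (𝓝[>] 0) (𝓝 V) := by
    simpa using (tendsto_tan_div_nhdsGT_zero.pow m).mul_const V
  have hlow : Tendsto (fun δ : ℝ => (Real.tan δ / δ * (1 - Real.tan δ ^ 2 / 4)) ^ m * V)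
      (𝓝[>] 0) (𝓝 V) := by
    have := ((tendsto_tan_div_nhdsGT_zero.mul
      (((tendsto_tan_nhdsGT_zero.pow 2).div_const 4).const_sub 1)).pow m).mul_const V
    simpa using this
  refine tendsto_of_tendsto_of_tendsto_of_le_of_le' hlow hup ?_ ?_
  · filter_upwards [eventually_lt_nhdsGT_zero (half_pos Real.pi_pos), htan2] with δ hδ h4
    have htδ : 0 < Real.tan δ := Real.tan_pos_of_pos_of_lt_pi_div_two hδ.1 hδ.2
    rw [le_div_iff₀ (pow_pos hδ.1 m)]
    calc _ = (Real.tan δ * (1 - Real.tan δ ^ 2 / 4)) ^ m * V := by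
          have := hδ.1.ne'
          rw [mul_right_comm, ← mul_pow]; congr 2; field_simp
      _ = volume.real _ := (volume_preimage_lens hm (mul_nonneg htδ.le (by linarith)) hr hΦ x).symm
      _ ≤ _ := measureReal_mono (lens_subset_spindle hδ.1 hδ.2 h4 hxy hΦ1 hΦ2) (by
          refine ne_top_of_le_ne_top ?_
            (measure_mono (spindle_subset_lens hδ.1 hδ.2 hxy hΦ1 hΦ2))
          have h := (hΦ.comp (measurePreserving_sub_right volume x)).measure_preimage
            (measurableSet_lens m (Real.tan δ) ‖y - x‖).nullMeasurableSet
          rw [volume_lens hm htδ.le hr] at h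
          exact h.trans_ne ENNReal.ofReal_ne_top)
  · filter_upwards [eventually_lt_nhdsGT_zero (half_pos Real.pi_pos)] with δ hδ
    have htδ : 0 < Real.tan δ := Real.tan_pos_of_pos_of_lt_pi_div_two hδ.1 hδ.2
    rw [div_le_iff₀ (pow_pos hδ.1 m)]
    calc _ ≤ volume.real _ :=
          measureReal_mono (spindle_subset_lens hδ.1 hδ.2 hxy hΦ1 hΦ2) (by
            have h := (hΦ.comp (measurePreserving_sub_right volume x)).measure_preimage
              (measurableSet_lens m (Real.tan δ) ‖y - x‖).nullMeasurableSet
            rw [volume_lens hm htδ.le hr] at h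
            exact h.trans_ne ENNReal.ofReal_ne_top)
      _ = (Real.tan δ) ^ m * V := volume_preimage_lens hm htδ.le hr hΦ x
      _ = _ := by
          have := hδ.1.ne'
          rw [mul_right_comm, ← mul_pow, div_mul_cancel₀ _ this]

/-- In a convex open set, the points seeing a given segment under an angle at least `π - δ` all
lie in the set once `δ` is small: they are within `tan δ * ‖y - x‖` of the segment. -/
theorem eventually_spindle_subset {m : ℕ} {U : Set (EuclideanSpace ℝ (Fin (m + 1)))}
    (hUo : IsOpen U) (hUc : Convex ℝ U) {x y : EuclideanSpace ℝ (Fin (m + 1))} (hx : x ∈ U)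
    (hy : y ∈ U) : ∀ᶠ δ in 𝓝[>] 0, spindle δ x y ⊆ U := by
  by_cases hxy : x = y
  · subst hxy
    filter_upwards [eventually_lt_nhdsGT_zero (half_pos Real.pi_pos)] with δ hδ
    rw [spindle_self hδ.2]; exact Set.empty_subset U
  obtain ⟨Φ, hΦ, hΦ1, hΦ2⟩ := exists_measurePreserving_coords _ (norm_inv_norm_smul_sub hxy)
  have hr : 0 < ‖y - x‖ := norm_pos_iff.2 (sub_ne_zero.2 (Ne.symm hxy))
  have hcomp : IsCompact (segment ℝ x y) := by
    rw [segment_eq_image_lineMap]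
    exact isCompact_Icc.image (by fun_prop)
  obtain ⟨ε, hε, hsub⟩ := hcomp.exists_thickening_subset_open hUo (hUc.segment_subset hx hy)
  have hsmall : ∀ᶠ δ : ℝ in 𝓝[>] 0, Real.tan δ * ‖y - x‖ < ε := by
    have : Tendsto (fun δ : ℝ => Real.tan δ * ‖y - x‖) (𝓝[>] 0) (𝓝 0) := by
      simpa using tendsto_tan_nhdsGT_zero.mul_const ‖y - x‖
    exact this.eventually (gt_mem_nhds hε)
  filter_upwards [eventually_lt_nhdsGT_zero (half_pos Real.pi_pos), hsmall] with δ hδ hsm z hz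
  have htδ : 0 < Real.tan δ := Real.tan_pos_of_pos_of_lt_pi_div_two hδ.1 hδ.2
  obtain ⟨⟨ht0, htr⟩, hh⟩ := spindle_subset_lens hδ.1 hδ.2 hxy hΦ1 hΦ2 hz
  refine hsub (Metric.mem_thickening_iff.2
    ⟨x + ((Φ (z - x)).1 / ‖y - x‖) • (y - x), ?_, ?_⟩)
  · rw [segment_eq_image']
    exact ⟨_, ⟨div_nonneg ht0.le hr.le, (div_le_one hr).2 htr.le⟩, rfl⟩
  · have hu := norm_inv_norm_smul_sub hxy
    have e : z - (x + ((Φ (z - x)).1 / ‖y - x‖) • (y - x)) =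
        (z - x) - (Φ (z - x)).1 • (‖y - x‖⁻¹ • (y - x)) := by
      rw [smul_smul, div_eq_mul_inv]; abel
    have e2 : ‖z - (x + ((Φ (z - x)).1 / ‖y - x‖) • (y - x))‖ ^ 2 = ‖(Φ (z - x)).2‖ ^ 2 := by
      rw [e, norm_sub_sq_real, norm_smul, hu, inner_smul_right, real_inner_comm, ← hΦ1, hΦ2,
        mul_one, Real.norm_eq_abs, sq_abs]
      ring
    rw [dist_eq_norm, (pow_left_inj₀ (norm_nonneg _) (norm_nonneg _) two_ne_zero).1 e2]
    refine lt_of_le_of_lt ?_ hsm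
    refine le_of_mul_le_mul_left ?_ hr
    calc ‖y - x‖ * ‖(Φ (z - x)).2‖ ≤ Real.tan δ * ((Φ (z - x)).1 * (‖y - x‖ - (Φ (z - x)).1)) := hh
      _ ≤ Real.tan δ * (‖y - x‖ * ‖y - x‖) := by
          refine mul_le_mul_of_nonneg_left ?_ htδ.le
          exact mul_le_mul htr.le (by linarith) (by linarith) hr.le
      _ = _ := by ring

/-! ### Nearly flat triangles with two given vertices -/

/-- The triangle with vertices `x`, `y`, `z` has an angle of at least `π - δ`. -/
def IsFlat {m : ℕ} (δ : ℝ) (x y z : EuclideanSpace ℝ (Fin m)) : Prop :=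
  Real.pi - δ ≤ ∠ x z y ∨ Real.pi - δ ≤ ∠ y x z ∨ Real.pi - δ ≤ ∠ z y x

theorem IsFlat.ne {m : ℕ} {δ : ℝ} (h1 : δ < Real.pi / 2) {x y z : EuclideanSpace ℝ (Fin m)}
    (h : IsFlat δ x y z) : x ≠ y := by
  rintro rfl
  have hs (w) : ¬ Real.pi - δ ≤ ∠ x w x := by
    have := spindle_self h1 x
    exact fun hw => (this ▸ (show w ∈ spindle δ x x from hw) : w ∈ (∅ : Set _))
  rcases h with h | h | h
  · exact hs _ h
  · rw [EuclideanGeometry.angle_self_left] at h; linarith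
  · rw [EuclideanGeometry.angle_self_right] at h; linarith

theorem IsFlat.sin_angle_le {m : ℕ} {δ : ℝ} {x y z : EuclideanSpace ℝ (Fin m)}
    (h : IsFlat δ x y z) (hxy : x ≠ y) : Real.sin (∠ y x z) ≤ δ := by
  have hsum := EuclideanGeometry.angle_add_angle_add_angle_eq_pi z hxy
  have h1 : 0 ≤ ∠ y x z := EuclideanGeometry.angle_nonneg _ _ _
  have h2 : 0 ≤ ∠ x z y := EuclideanGeometry.angle_nonneg _ _ _
  have h3 : 0 ≤ ∠ z y x := EuclideanGeometry.angle_nonneg _ _ _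
  have h4 : ∠ y x z ≤ Real.pi := EuclideanGeometry.angle_le_pi _ _ _
  rcases h with h | h | h
  · exact (Real.sin_le h1).trans (by linarith)
  · rw [← Real.sin_pi_sub]; exact (Real.sin_le (by linarith)).trans (by linarith)
  · exact (Real.sin_le h1).trans (by linarith)

/-- A point `z` within distance `D` of `x` that makes a nearly flat triangle with `x`, `y` lies in
a cylinder of radius `D δ` around the line through `x` and `y`. -/
theorem exists_volume_isFlat_le {m : ℕ} (hm : 0 < m) {D : ℝ} (hD : 0 ≤ D) :
    ∃ C, 0 ≤ C ∧ ∀ δ, 0 < δ → δ < Real.pi / 2 → ∀ x y : EuclideanSpace ℝ (Fin (m + 1)),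
      volume {z | ‖z - x‖ ≤ D ∧ IsFlat δ x y z} ≤ ENNReal.ofReal (C * δ ^ m) := by
  have : Nonempty (Fin m) := ⟨⟨0, hm⟩⟩
  have g2 : 0 < Real.Gamma ((m : ℝ) / 2 + 1) := Real.Gamma_pos_of_pos (by positivity)
  refine ⟨2 * D * (D ^ m * (√Real.pi ^ m / Real.Gamma ((m : ℝ) / 2 + 1))), by positivity,
    fun δ h0 h1 x y => ?_⟩
  by_cases hxy : x = y
  · have : {z | ‖z - x‖ ≤ D ∧ IsFlat δ x y z} = ∅ := by
      ext z
      simp only [Set.mem_ofPred_eq, Set.mem_empty_iff_false, iff_false]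
      exact fun h => h.2.ne h1 hxy
    rw [this, measure_empty]; exact zero_le
  obtain ⟨Φ, hΦ, hΦ1, hΦ2⟩ := exists_measurePreserving_coords _ (norm_inv_norm_smul_sub hxy)
  have hr : 0 < ‖y - x‖ := norm_pos_iff.2 (sub_ne_zero.2 (Ne.symm hxy))
  have hsub : {z | ‖z - x‖ ≤ D ∧ IsFlat δ x y z} ⊆ (fun z => Φ (z - x)) ⁻¹'
      (Set.Icc (-D) D ×ˢ Metric.closedBall (0 : EuclideanSpace ℝ (Fin m)) (D * δ)) := by
    rintro z ⟨hzD, hz⟩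
    have hsin := hz.sin_angle_le hxy
    have hcos : Real.cos (∠ y x z) * (‖y - x‖ * ‖z - x‖) = inner ℝ (y - x) (z - x) :=
      InnerProductGeometry.cos_angle_mul_norm_mul_norm (y - x) (z - x)
    have ht : (Φ (z - x)).1 = ‖z - x‖ * Real.cos (∠ y x z) := by
      rw [hΦ1, real_inner_smul_left, ← hcos]; field_simp
    have hw : ‖(Φ (z - x)).2‖ ^ 2 = (‖z - x‖ * Real.sin (∠ y x z)) ^ 2 := by
      have := hΦ2 (z - x)
      rw [ht] at this
      rw [mul_pow, Real.sin_sq]; linarith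
    have hs0 : 0 ≤ Real.sin (∠ y x z) := InnerProductGeometry.sin_angle_nonneg _ _
    have hw' := (pow_left_inj₀ (norm_nonneg _) (mul_nonneg (norm_nonneg _) hs0) two_ne_zero).1 hw
    refine ⟨abs_le.1 ?_, mem_closedBall_zero_iff.2 ?_⟩
    · rw [ht, abs_mul, abs_norm]
      calc _ ≤ ‖z - x‖ * 1 := mul_le_mul_of_nonneg_left (Real.abs_cos_le_one _) (norm_nonneg _)
        _ ≤ D := by rwa [mul_one]
    · rw [hw']; exact mul_le_mul hzD hsin hs0 hD
  refine (measure_mono hsub).trans_eq ?_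
  have h := (hΦ.comp (measurePreserving_sub_right volume x)).measure_preimage
    ((measurableSet_Icc (a := -D) (b := D)).prod (Metric.isClosed_closedBall
      (x := (0 : EuclideanSpace ℝ (Fin m))) (ε := D * δ)).measurableSet).nullMeasurableSet
  refine h.trans ?_
  rw [Measure.volume_eq_prod, Measure.prod_prod, Real.volume_Icc, EuclideanSpace.volume_closedBall,
    Fintype.card_fin, ← ENNReal.ofReal_pow (by positivity), ← ENNReal.ofReal_mul (by positivity),
    ← ENNReal.ofReal_mul (by linarith)]
  congr 1
  rw [mul_pow]; ring

theorem measurable_angle {α : Type*} [MeasurableSpace α] {m : ℕ}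
    {f g h : α → EuclideanSpace ℝ (Fin m)} (hf : Measurable f) (hg : Measurable g)
    (hh : Measurable h) : Measurable fun a => ∠ (f a) (g a) (h a) := by
  have : (fun a => ∠ (f a) (g a) (h a)) = fun a => Real.arccos
      (inner ℝ (f a - g a) (h a - g a) / (‖f a - g a‖ * ‖h a - g a‖)) := rfl
  rw [this]
  exact Real.continuous_arccos.measurable.comp (by fun_prop)

/-! ### The probability that a random triangle is nearly flat -/

section Uniform

variable {m : ℕ} {U : Set (EuclideanSpace ℝ (Fin (m + 1)))}

theorem isProbabilityMeasure_uniformLaw (hUo : IsOpen U) (hUb : Bornology.IsBounded U)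
    (hUn : U.Nonempty) : IsProbabilityMeasure (uniformLaw U) :=
  cond_isProbabilityMeasure_of_finite (hUo.measure_pos volume hUn).ne' hUb.measure_lt_top.ne

theorem uniformLaw_real_apply (hUo : IsOpen U) (S : Set (EuclideanSpace ℝ (Fin (m + 1)))) :
    (uniformLaw U).real S = volume.real (U ∩ S) / volume.real U := by
  rw [uniformLaw, measureReal_def, cond_apply hUo.measurableSet, ENNReal.toReal_mul,
    ENNReal.toReal_inv, div_eq_inv_mul, measureReal_def, measureReal_def]

theorem ae_mem_uniformLaw (hUo : IsOpen U) : ∀ᵐ x ∂uniformLaw U, x ∈ U :=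
  ae_cond_mem hUo.measurableSet

theorem exists_uniformLaw_isFlat_le (hm : 0 < m) (hUo : IsOpen U) (hUb : Bornology.IsBounded U) :
    ∃ C, 0 ≤ C ∧ ∀ δ, 0 < δ → δ < Real.pi / 2 → ∀ x ∈ U, ∀ y,
      (uniformLaw U).real {z | IsFlat δ x y z} ≤ C * δ ^ m := by
  obtain ⟨D, hD⟩ := hUb.exists_norm_le
  obtain ⟨C, hC0, hC⟩ := exists_volume_isFlat_le hm (D := 2 * |D|) (by positivity)
  refine ⟨C / volume.real U, by positivity, fun δ h0 h1 x hx y => ?_⟩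
  rw [uniformLaw_real_apply hUo, div_mul_eq_mul_div]
  refine div_le_div_of_nonneg_right ?_ measureReal_nonneg
  have hsub : U ∩ {z | IsFlat δ x y z} ⊆ {z | ‖z - x‖ ≤ 2 * |D| ∧ IsFlat δ x y z} := by
    rintro z ⟨hzU, hz⟩
    refine ⟨(norm_sub_le _ _).trans ?_, hz⟩
    linarith [hD z hzU, hD x hx, le_abs_self D]
  refine ENNReal.toReal_le_of_le_ofReal (by positivity) ((measure_mono hsub).trans (hC δ h0 h1 x y))

theorem tendsto_uniformLaw_spindle_div (hm : 0 < m) (hUo : IsOpen U) (hUc : Convex ℝ U)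
    {x y : EuclideanSpace ℝ (Fin (m + 1))} (hx : x ∈ U) (hy : y ∈ U) :
    Tendsto (fun δ => (uniformLaw U).real (spindle δ x y) / δ ^ m) (𝓝[>] 0)
      (𝓝 (angleRho (m + 1) / volume.real U * ‖x - y‖ ^ (m + 1))) := by
  have h := (tendsto_volume_spindle_div hm x y).div_const (volume.real U)
  rw [div_mul_eq_mul_div]
  refine h.congr' ?_
  filter_upwards [eventually_spindle_subset hUo hUc hx hy] with δ hδ
  rw [uniformLaw_real_apply hUo, Set.inter_eq_right.2 hδ, div_right_comm]

theorem measurable_uniformLaw_spindle (hUo : IsOpen U) (hUb : Bornology.IsBounded U)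
    (hUn : U.Nonempty) (δ : ℝ) :
    Measurable fun p : EuclideanSpace ℝ (Fin (m + 1)) × EuclideanSpace ℝ (Fin (m + 1)) =>
      (uniformLaw U).real (spindle δ p.1 p.2) := by
  have := isProbabilityMeasure_uniformLaw hUo hUb hUn
  have hS : MeasurableSet {q : (EuclideanSpace ℝ (Fin (m + 1)) × EuclideanSpace ℝ (Fin (m + 1))) ×
      EuclideanSpace ℝ (Fin (m + 1)) | Real.pi - δ ≤ ∠ q.1.1 q.2 q.1.2} :=
    measurableSet_le measurable_const (measurable_angle (by fun_prop) (by fun_prop) (by fun_prop))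
  exact (measurable_measure_prodMk_left (ν := uniformLaw U) hS).ennreal_toReal

/-- For independent uniform points `P`, `Q`, `R` in `U`, the probability that the angle at `R` is
at least `π - δ` is asymptotic to `(ρ 𝔼‖P - Q‖ ^ d / Vol U) δ ^ (d - 1)`. -/
theorem tendsto_integral_uniformLaw_spindle_div (hm : 0 < m) (hUo : IsOpen U)
    (hUb : Bornology.IsBounded U) (hUc : Convex ℝ U) (hUn : U.Nonempty) :
    Tendsto (fun δ => (∫ p, (uniformLaw U).real (spindle δ p.1 p.2)
        ∂((uniformLaw U).prod (uniformLaw U))) / δ ^ m) (𝓝[>] 0)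
      (𝓝 (elongation U / 3)) := by
  have := isProbabilityMeasure_uniformLaw hUo hUb hUn
  obtain ⟨C, hC0, hC⟩ := exists_uniformLaw_isFlat_le hm hUo hUb
  have hae : ∀ᵐ p ∂((uniformLaw U).prod (uniformLaw U)), p.1 ∈ U ∧ p.2 ∈ U :=
    (Measure.quasiMeasurePreserving_fst.ae (ae_mem_uniformLaw hUo)).and
      (Measure.quasiMeasurePreserving_snd.ae (ae_mem_uniformLaw hUo))
  have key := tendsto_integral_filter_of_dominated_convergence
    (μ := (uniformLaw U).prod (uniformLaw U)) (l := 𝓝[>] (0 : ℝ))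
    (F := fun δ p => (uniformLaw U).real (spindle δ p.1 p.2) / δ ^ m)
    (f := fun p => angleRho (m + 1) / volume.real U * ‖p.1 - p.2‖ ^ (m + 1))
    (fun _ => C)
    (Eventually.of_forall fun δ =>
      ((measurable_uniformLaw_spindle hUo hUb hUn δ).div_const _).aestronglyMeasurable)
    (by
      filter_upwards [eventually_lt_nhdsGT_zero (half_pos Real.pi_pos)] with δ hδ
      filter_upwards [hae] with p hp
      have hδm : 0 < δ ^ m := pow_pos hδ.1 m
      rw [Real.norm_of_nonneg (div_nonneg measureReal_nonneg hδm.le), div_le_iff₀ hδm]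
      refine le_trans (measureReal_mono fun z hz => ?_) (hC δ hδ.1 hδ.2 p.1 hp.1 p.2)
      exact Or.inl hz)
    (integrable_const C)
    (by
      filter_upwards [hae] with p hp
      exact tendsto_uniformLaw_spindle_div hm hUo hUc hp.1 hp.2)
  have e : elongation U / 3 = ∫ p, angleRho (m + 1) / volume.real U * ‖p.1 - p.2‖ ^ (m + 1)
      ∂((uniformLaw U).prod (uniformLaw U)) := by
    rw [integral_const_mul, elongation]; ring
  rw [e]
  exact key.congr fun δ => integral_div _ _

theorem elongation_pos (hUo : IsOpen U) (hUb : Bornology.IsBounded U) (hUn : U.Nonempty) :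
    0 < elongation U := by
  have := isProbabilityMeasure_uniformLaw hUo hUb hUn
  have hae : ∀ᵐ p ∂((uniformLaw U).prod (uniformLaw U)), p.1 ∈ U ∧ p.2 ∈ U :=
    (Measure.quasiMeasurePreserving_fst.ae (ae_mem_uniformLaw hUo)).and
      (Measure.quasiMeasurePreserving_snd.ae (ae_mem_uniformLaw hUo))
  have hvol : 0 < volume.real U :=
    ENNReal.toReal_pos (hUo.measure_pos volume hUn).ne' hUb.measure_lt_top.ne
  have hint : 0 < ∫ p, ‖p.1 - p.2‖ ^ (m + 1) ∂((uniformLaw U).prod (uniformLaw U)) := by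
    obtain ⟨D, hD⟩ := hUb.exists_norm_le
    have hi : Integrable (fun p : EuclideanSpace ℝ (Fin (m + 1)) × EuclideanSpace ℝ (Fin (m + 1)) =>
        ‖p.1 - p.2‖ ^ (m + 1)) ((uniformLaw U).prod (uniformLaw U)) := by
      refine Integrable.of_bound (by fun_prop) ((D + D) ^ (m + 1)) ?_
      filter_upwards [hae] with p hp
      rw [norm_pow, norm_norm]
      exact pow_le_pow_left₀ (norm_nonneg _)
        ((norm_sub_le _ _).trans (add_le_add (hD _ hp.1) (hD _ hp.2))) _
    rw [integral_pos_iff_support_of_nonneg (fun p => by positivity) hi, pos_iff_ne_zero]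
    intro h0
    -- otherwise the diagonal has full measure, although its sections are singletons
    have hdiag : ∀ᵐ p ∂((uniformLaw U).prod (uniformLaw U)), p.1 = p.2 := by
      refine measure_mono_null (fun p hp => ?_) h0
      simpa [sub_eq_zero] using hp
    have h1 := Measure.ae_ae_of_ae_prod hdiag
    have h2 : ∀ᵐ x ∂uniformLaw U, False := by
      filter_upwards [h1] with x hx
      have h3 : (uniformLaw U) {x}ᶜ = 0 := by
        refine measure_mono_null (fun y hy => ?_) hx
        exact fun h => hy h.symm
      have h4 : (uniformLaw U) {x} = 0 :=
        cond_absolutelyContinuous (measure_singleton x)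
      have := measure_univ (μ := uniformLaw U)
      rw [← Set.union_compl_self {x}] at this
      have h5 := measure_union_le (μ := uniformLaw U) {x} {x}ᶜ
      rw [this, h3, h4] at h5
      simp at h5
    simp at h2
    exact IsProbabilityMeasure.ne_zero _ h2
  have := angleRho_succ_pos m
  unfold elongation
  positivity

end Uniform

/-! ### Nearly flat triangles among the points of a sequence -/

/-- Some triangle with vertices `p i`, `i ∈ t`, has an angle of at least `π - δ`. -/
def HasFlatTriangle {m : ℕ} (δ : ℝ) (t : Finset ℕ) (p : ℕ → EuclideanSpace ℝ (Fin m)) : Prop :=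
  ∃ i ∈ t, ∃ j ∈ t, ∃ k ∈ t, i ≠ j ∧ j ≠ k ∧ i ≠ k ∧ Real.pi - δ ≤ ∠ (p i) (p j) (p k)

theorem hasFlatTriangle_congr {m : ℕ} {δ : ℝ} {t : Finset ℕ}
    {p q : ℕ → EuclideanSpace ℝ (Fin m)} (h : ∀ i ∈ t, p i = q i) :
    HasFlatTriangle δ t p ↔ HasFlatTriangle δ t q := by
  have aux {p q : ℕ → EuclideanSpace ℝ (Fin m)} (h : ∀ i ∈ t, p i = q i) :
      HasFlatTriangle δ t p → HasFlatTriangle δ t q := by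
    rintro ⟨i, hi, j, hj, k, hk, h1, h2, h3, h4⟩
    exact ⟨i, hi, j, hj, k, hk, h1, h2, h3, by rwa [← h i hi, ← h j hj, ← h k hk]⟩
  exact ⟨aux h, aux fun i hi => (h i hi).symm⟩

theorem hasFlatTriangle_triple {m : ℕ} {δ : ℝ} {p : ℕ → EuclideanSpace ℝ (Fin m)} {i j k : ℕ}
    (hij : i ≠ j) (hik : i ≠ k) (hjk : j ≠ k) :
    HasFlatTriangle δ {i, j, k} p ↔ IsFlat δ (p i) (p j) (p k) := by
  constructor
  · rintro ⟨a, ha, b, hb, c, hc, hab, hbc, hac, h⟩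
    simp only [Finset.mem_insert, Finset.mem_singleton] at ha hb hc
    unfold IsFlat
    rcases ha with rfl | rfl | rfl <;> rcases hb with rfl | rfl | rfl <;>
      rcases hc with rfl | rfl | rfl <;> first | contradiction | skip
    all_goals first
      | exact Or.inl h
      | exact Or.inr (Or.inl h)
      | exact Or.inr (Or.inr h)
      | (rw [EuclideanGeometry.angle_comm] at h
         first
          | exact Or.inl h
          | exact Or.inr (Or.inl h)
          | exact Or.inr (Or.inr h))
  · rintro (h | h | h)
    · exact ⟨i, by simp, k, by simp, j, by simp, hik, hjk.symm, hij, h⟩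
    · exact ⟨j, by simp, i, by simp, k, by simp, hij.symm, hik, hjk, h⟩
    · exact ⟨k, by simp, j, by simp, i, by simp, hjk.symm, hij.symm, hik.symm, h⟩

theorem mem_triples {n : ℕ} {t : Finset ℕ} : t ∈ triples n ↔ t ⊆ Finset.range n ∧ t.card = 3 :=
  Finset.mem_powersetCard

theorem triangleMaxAngle_lt_iff {m : ℕ} {δ : ℝ} {t : Finset ℕ} (ht : t.card = 3)
    (p : ℕ → EuclideanSpace ℝ (Fin m)) :
    triangleMaxAngle p t < Real.pi - δ ↔ ¬ HasFlatTriangle δ t p := by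
  have hfin : {θ : ℝ | ∃ i ∈ t, ∃ j ∈ t, ∃ k ∈ t,
      i ≠ j ∧ j ≠ k ∧ i ≠ k ∧ θ = ∠ (p i) (p j) (p k)}.Finite := by
    refine ((t ×ˢ t ×ˢ t).finite_toSet.image
      fun q : ℕ × ℕ × ℕ => ∠ (p q.1) (p q.2.1) (p q.2.2)).subset ?_
    rintro θ ⟨i, hi, j, hj, k, hk, -, -, -, rfl⟩
    exact ⟨(i, j, k), by simp [hi, hj, hk], rfl⟩
  have hne : {θ : ℝ | ∃ i ∈ t, ∃ j ∈ t, ∃ k ∈ t,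
      i ≠ j ∧ j ≠ k ∧ i ≠ k ∧ θ = ∠ (p i) (p j) (p k)}.Nonempty := by
    obtain ⟨i, j, k, hij, hik, hjk, rfl⟩ := Finset.card_eq_three.1 ht
    exact ⟨_, i, by simp, j, by simp, k, by simp, hij, hjk, hik, rfl⟩
  rw [triangleMaxAngle, hfin.csSup_lt_iff hne]
  constructor
  · rintro h ⟨i, hi, j, hj, k, hk, h1, h2, h3, h4⟩
    exact absurd (h _ ⟨i, hi, j, hj, k, hk, h1, h2, h3, rfl⟩) (not_lt.2 h4)
  · rintro h θ ⟨i, hi, j, hj, k, hk, h1, h2, h3, rfl⟩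
    by_contra! h4
    exact h ⟨i, hi, j, hj, k, hk, h1, h2, h3, h4⟩

theorem maxAngle_lt_iff {m n : ℕ} {δ : ℝ} (hn : 3 ≤ n) (p : ℕ → EuclideanSpace ℝ (Fin m)) :
    maxAngle n p < Real.pi - δ ↔ ∀ t ∈ triples n, ¬ HasFlatTriangle δ t p := by
  have hne : (triples n : Set (Finset ℕ)).Nonempty :=
    Finset.coe_nonempty.2 (Finset.powersetCard_nonempty.2 (by simpa using hn))
  rw [maxAngle, ((triples n).finite_toSet.image _).csSup_lt_iff (hne.image _),
    Set.forall_mem_image]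
  refine forall₂_congr fun t ht => triangleMaxAngle_lt_iff (mem_triples.1 ht).2 p

theorem maxAngle_le_pi {m : ℕ} (n : ℕ) (p : ℕ → EuclideanSpace ℝ (Fin m)) :
    maxAngle n p ≤ Real.pi := by
  refine Real.sSup_le ?_ Real.pi_pos.le
  rintro _ ⟨t, -, rfl⟩
  refine Real.sSup_le ?_ Real.pi_pos.le
  rintro _ ⟨i, -, j, -, k, -, -, -, -, rfl⟩
  exact EuclideanGeometry.angle_le_pi _ _ _

theorem measurableSet_isFlat {α : Type*} [MeasurableSpace α] {m : ℕ} (δ : ℝ)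
    {f g h : α → EuclideanSpace ℝ (Fin m)} (hf : Measurable f) (hg : Measurable g)
    (hh : Measurable h) : MeasurableSet {a | IsFlat δ (f a) (g a) (h a)} :=
  (measurableSet_le measurable_const (measurable_angle hf hh hg)).union
    ((measurableSet_le measurable_const (measurable_angle hg hf hh)).union
      (measurableSet_le measurable_const (measurable_angle hh hg hf)))

theorem measurableSet_hasFlatTriangle {m : ℕ} (δ : ℝ) {t : Finset ℕ} (ht : t.card = 3) :
    MeasurableSet {p : ℕ → EuclideanSpace ℝ (Fin m) | HasFlatTriangle δ t p} := by
  obtain ⟨i, j, k, hij, hik, hjk, rfl⟩ := Finset.card_eq_three.1 ht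
  simp only [hasFlatTriangle_triple hij hik hjk]
  exact measurableSet_isFlat δ (by fun_prop) (by fun_prop) (by fun_prop)

/-- The indicator function of the event that the triple `t` spans a nearly flat triangle. -/
noncomputable def flatIndicator {m : ℕ} (δ : ℝ) (t : Finset ℕ) : (ℕ → EuclideanSpace ℝ (Fin m)) → ℝ :=
  Set.indicator {p | HasFlatTriangle δ t p} 1

theorem measurable_flatIndicator {m : ℕ} (δ : ℝ) {t : Finset ℕ} (ht : t.card = 3) :
    Measurable (flatIndicator (m := m) δ t) :=
  measurable_one.indicator (measurableSet_hasFlatTriangle δ ht)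

theorem flatIndicator_of_hasFlatTriangle {m : ℕ} {δ : ℝ} {t : Finset ℕ}
    {p : ℕ → EuclideanSpace ℝ (Fin m)} (h : HasFlatTriangle δ t p) : flatIndicator δ t p = 1 :=
  Set.indicator_of_mem (s := {p | HasFlatTriangle δ t p}) h 1

theorem flatIndicator_of_not_hasFlatTriangle {m : ℕ} {δ : ℝ} {t : Finset ℕ}
    {p : ℕ → EuclideanSpace ℝ (Fin m)} (h : ¬ HasFlatTriangle δ t p) : flatIndicator δ t p = 0 :=
  Set.indicator_of_notMem (s := {p | HasFlatTriangle δ t p}) h 1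

theorem flatIndicator_nonneg {m : ℕ} (δ : ℝ) (t : Finset ℕ) (p : ℕ → EuclideanSpace ℝ (Fin m)) :
    0 ≤ flatIndicator δ t p :=
  Set.indicator_nonneg (fun _ _ => zero_le_one) p

theorem flatIndicator_le_one {m : ℕ} (δ : ℝ) (t : Finset ℕ) (p : ℕ → EuclideanSpace ℝ (Fin m)) :
    flatIndicator δ t p ≤ 1 :=
  Set.indicator_le_self' (fun _ _ => zero_le_one) p

/-- The extension by zero of a finite family of points to a sequence. -/
noncomputable def extendZero {m : ℕ} (S : Finset ℕ) (r : S → EuclideanSpace ℝ (Fin m)) (i : ℕ) :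
    EuclideanSpace ℝ (Fin m) :=
  if h : i ∈ S then r ⟨i, h⟩ else 0

theorem measurable_extendZero {m : ℕ} (S : Finset ℕ) :
    Measurable (extendZero (m := m) S) := by
  refine measurable_pi_iff.2 fun i => ?_
  unfold extendZero
  by_cases h : i ∈ S
  · simp only [h, dite_true]; fun_prop
  · simp only [h, dite_false]; fun_prop

theorem flatIndicator_extendZero {m : ℕ} {δ : ℝ} {S t : Finset ℕ} (h : t ⊆ S)
    (p : ℕ → EuclideanSpace ℝ (Fin m)) :
    flatIndicator δ t (extendZero S fun i => p i) = flatIndicator δ t p := by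
  have : HasFlatTriangle δ t (extendZero S fun i => p i) ↔ HasFlatTriangle δ t p :=
    hasFlatTriangle_congr fun i hi => by simp [extendZero, h hi]
  by_cases hp : HasFlatTriangle δ t p
  · rw [flatIndicator_of_hasFlatTriangle hp, flatIndicator_of_hasFlatTriangle (this.2 hp)]
  · rw [flatIndicator_of_not_hasFlatTriangle hp,
      flatIndicator_of_not_hasFlatTriangle (mt this.1 hp)]

/-! ### Probabilities of nearly flat triangles among independent points -/

section Random

variable {m : ℕ} {U : Set (EuclideanSpace ℝ (Fin (m + 1)))}
  {Ω : Type*} [MeasurableSpace Ω] {μ : Measure Ω}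
  {P : ℕ → Ω → EuclideanSpace ℝ (Fin (m + 1))}

theorem measurable_path (hPm : ∀ i, Measurable (P i)) : Measurable fun ω i => P i ω :=
  measurable_pi_iff.2 hPm

theorem integral_flatIndicator (hPm : ∀ i, Measurable (P i)) (δ : ℝ) {t : Finset ℕ}
    (ht : t.card = 3) :
    ∫ ω, flatIndicator δ t (fun i => P i ω) ∂μ =
      μ.real {ω | HasFlatTriangle δ t fun i => P i ω} := by
  have hB : MeasurableSet {ω | HasFlatTriangle δ t fun i => P i ω} :=
    measurable_path hPm (measurableSet_hasFlatTriangle δ ht)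
  rw [← integral_indicator_one hB]
  rfl

theorem integral_flatIndicator_mul (hPm : ∀ i, Measurable (P i)) (δ : ℝ) {s t : Finset ℕ}
    (hs : s.card = 3) (ht : t.card = 3) :
    ∫ ω, flatIndicator δ s (fun i => P i ω) * flatIndicator δ t (fun i => P i ω) ∂μ =
      μ.real {ω | HasFlatTriangle δ s (fun i => P i ω) ∧ HasFlatTriangle δ t fun i => P i ω} := by
  have hB (t : Finset ℕ) (ht : t.card = 3) :
      MeasurableSet {ω | HasFlatTriangle δ t fun i => P i ω} :=
    measurable_path hPm (measurableSet_hasFlatTriangle δ ht)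
  rw [Set.ofPred_and, ← integral_indicator_one ((hB s hs).inter (hB t ht)),
    Set.inter_indicator_one]
  rfl

theorem indepFun_flatIndicator_prod (hPm : ∀ i, Measurable (P i)) (hPind : iIndepFun P μ)
    (δ s : ℝ) {t : Finset ℕ} (ht : t.card = 3) {Q : Finset (Finset ℕ)}
    (hQ : ∀ q ∈ Q, q.card = 3 ∧ Disjoint q t) :
    IndepFun (fun ω => flatIndicator δ t fun i => P i ω)
      (fun ω => ∏ q ∈ Q, (1 - s * flatIndicator δ q fun i => P i ω)) μ := by
  have hdisj : Disjoint t (Q.biUnion id) :=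
    (Finset.disjoint_biUnion_right _ _ _).2 fun q hq => (hQ q hq).2.symm
  have h := hPind.indepFun_finset t (Q.biUnion id) hdisj hPm
  have h2 := h.comp (φ := fun r => flatIndicator δ t (extendZero t r))
    (ψ := fun r => ∏ q ∈ Q, (1 - s * flatIndicator δ q (extendZero (Q.biUnion id) r)))
    ((measurable_flatIndicator δ ht).comp (measurable_extendZero t))
    (Finset.measurable_fun_prod _ fun q hq => (((measurable_flatIndicator δ (hQ q hq).1).comp
      (measurable_extendZero _)).const_mul s).const_sub 1)
  have e1 : (fun r => flatIndicator δ t (extendZero t r)) ∘ (fun ω (i : t) => P i ω) =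
      fun ω => flatIndicator δ t fun i => P i ω := by
    ext ω; exact flatIndicator_extendZero subset_rfl fun i => P i ω
  have e2 : (fun r => ∏ q ∈ Q, (1 - s * flatIndicator δ q (extendZero (Q.biUnion id) r))) ∘
      (fun ω (i : (Q.biUnion id : Finset ℕ)) => P i ω) =
      fun ω => ∏ q ∈ Q, (1 - s * flatIndicator δ q fun i => P i ω) := by
    ext ω
    refine Finset.prod_congr rfl fun q hq => ?_
    exact congrArg (fun x => 1 - s * x)
      (flatIndicator_extendZero (Finset.subset_biUnion_of_mem id hq) fun i => P i ω)
  rwa [e1, e2] at h2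

variable [IsProbabilityMeasure μ]

theorem measureReal_angle_ge (hPm : ∀ i, Measurable (P i)) (hPind : iIndepFun P μ)
    (hPunif : ∀ i, μ.map (P i) = uniformLaw U) [IsProbabilityMeasure (uniformLaw U)] (δ : ℝ)
    {i j k : ℕ} (hij : i ≠ j) (hik : i ≠ k) (hjk : j ≠ k) :
    μ.real {ω | Real.pi - δ ≤ ∠ (P i ω) (P k ω) (P j ω)} =
      ∫ p, (uniformLaw U).real (spindle δ p.1 p.2)
        ∂((uniformLaw U).prod (uniformLaw U)) := by
  have h1 : μ.map (fun ω => (P i ω, P j ω)) = (uniformLaw U).prod (uniformLaw U) := by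
    have := (indepFun_iff_map_prod_eq_prod_map_map (hPm i).aemeasurable
      (hPm j).aemeasurable).1 (hPind.indepFun hij)
    rwa [hPunif, hPunif] at this
  have h2 : μ.map (fun ω => ((P i ω, P j ω), P k ω)) =
      ((uniformLaw U).prod (uniformLaw U)).prod (uniformLaw U) := by
    have := (indepFun_iff_map_prod_eq_prod_map_map ((hPm i).prodMk (hPm j)).aemeasurable
      (hPm k).aemeasurable).1 (hPind.indepFun_prodMk hPm i j k hik hjk)
    rwa [h1, hPunif] at this
  have hS : MeasurableSet {q : (EuclideanSpace ℝ (Fin (m + 1)) × EuclideanSpace ℝ (Fin (m + 1))) ×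
      EuclideanSpace ℝ (Fin (m + 1)) | Real.pi - δ ≤ ∠ q.1.1 q.2 q.1.2} :=
    measurableSet_le measurable_const (measurable_angle (by fun_prop) (by fun_prop) (by fun_prop))
  have h3 : μ {ω | Real.pi - δ ≤ ∠ (P i ω) (P k ω) (P j ω)} =
      ∫⁻ p, (uniformLaw U) (spindle δ p.1 p.2) ∂((uniformLaw U).prod (uniformLaw U)) := by
    rw [show {ω | Real.pi - δ ≤ ∠ (P i ω) (P k ω) (P j ω)} =
      (fun ω => ((P i ω, P j ω), P k ω)) ⁻¹' {q | Real.pi - δ ≤ ∠ q.1.1 q.2 q.1.2} from rfl,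
      ← Measure.map_apply (((hPm i).prodMk (hPm j)).prodMk (hPm k)) hS, h2,
      Measure.prod_apply hS]
    rfl
  rw [measureReal_def, h3]
  exact (integral_toReal (measurable_measure_prodMk_left (ν := uniformLaw U) hS).aemeasurable
    (Eventually.of_forall fun _ => measure_lt_top _ _)).symm

/-- For `δ < π / 2` at most one angle of a triangle is at least `π - δ`, so the probability that a
random triangle is nearly flat is three times the one for a given vertex. -/
theorem measureReal_isFlat (hPm : ∀ i, Measurable (P i)) (hPind : iIndepFun P μ)
    (hPunif : ∀ i, μ.map (P i) = uniformLaw U) [IsProbabilityMeasure (uniformLaw U)] {δ : ℝ}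
    (h1 : δ < Real.pi / 2) {i j k : ℕ} (hij : i ≠ j) (hik : i ≠ k) (hjk : j ≠ k) :
    μ.real {ω | IsFlat δ (P i ω) (P j ω) (P k ω)} =
      3 * ∫ p, (uniformLaw U).real (spindle δ p.1 p.2)
        ∂((uniformLaw U).prod (uniformLaw U)) := by
  have hsplit : {ω | IsFlat δ (P i ω) (P j ω) (P k ω)} =
      {ω | Real.pi - δ ≤ ∠ (P i ω) (P k ω) (P j ω)} ∪
        ({ω | Real.pi - δ ≤ ∠ (P j ω) (P i ω) (P k ω)} ∪
          {ω | Real.pi - δ ≤ ∠ (P k ω) (P j ω) (P i ω)}) := rfl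
  have hmeas (i j k : ℕ) : MeasurableSet {ω | Real.pi - δ ≤ ∠ (P i ω) (P j ω) (P k ω)} :=
    measurableSet_le measurable_const (measurable_angle (hPm i) (hPm j) (hPm k))
  have hsum (ω) (hf : IsFlat δ (P i ω) (P j ω) (P k ω)) :=
    EuclideanGeometry.angle_add_angle_add_angle_eq_pi (P k ω) (hf.ne h1)
  have hn (a b c : ℕ) (ω) : 0 ≤ ∠ (P a ω) (P b ω) (P c ω) := EuclideanGeometry.angle_nonneg _ _ _
  have hd1 : Disjoint {ω | Real.pi - δ ≤ ∠ (P i ω) (P k ω) (P j ω)}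
      ({ω | Real.pi - δ ≤ ∠ (P j ω) (P i ω) (P k ω)} ∪
          {ω | Real.pi - δ ≤ ∠ (P k ω) (P j ω) (P i ω)}) := by
    refine Set.disjoint_left.2 fun ω hω hω' => ?_
    have hs := hsum ω (Or.inl hω)
    have hω1 : Real.pi - δ ≤ ∠ (P i ω) (P k ω) (P j ω) := hω
    rcases hω' with hω' | hω'
    · have hω2 : Real.pi - δ ≤ ∠ (P j ω) (P i ω) (P k ω) := hω'
      linarith [hn k j i ω]
    · have hω2 : Real.pi - δ ≤ ∠ (P k ω) (P j ω) (P i ω) := hω'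
      linarith [hn j i k ω]
  have hd2 : Disjoint {ω | Real.pi - δ ≤ ∠ (P j ω) (P i ω) (P k ω)}
          {ω | Real.pi - δ ≤ ∠ (P k ω) (P j ω) (P i ω)} := by
    refine Set.disjoint_left.2 fun ω hω hω' => ?_
    have hs := hsum ω (Or.inr (Or.inl hω))
    have hω1 : Real.pi - δ ≤ ∠ (P j ω) (P i ω) (P k ω) := hω
    have hω2 : Real.pi - δ ≤ ∠ (P k ω) (P j ω) (P i ω) := hω'
    linarith [hn i k j ω]
  rw [hsplit, measureReal_union hd1 ((hmeas _ _ _).union (hmeas _ _ _)),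
    measureReal_union hd2 (hmeas _ _ _), measureReal_angle_ge hPm hPind hPunif δ hij hik hjk,
    measureReal_angle_ge hPm hPind hPunif δ hjk hij.symm hik.symm,
    measureReal_angle_ge hPm hPind hPunif δ hik.symm hjk.symm hij]
  ring

theorem measureReal_inter_le_of_indepFun {β γ : Type*} [MeasurableSpace β] [MeasurableSpace γ]
    {R : Ω → γ} {X : Ω → β} (hR : Measurable R) (hX : Measurable X) (hind : IndepFun R X μ)
    {A : Set γ} (hA : MeasurableSet A) {S : Set (γ × β)} (hS : MeasurableSet S) {c : ℝ}
    (hc : 0 ≤ c) (h : ∀ᵐ ω ∂μ, (μ.map X).real {x | (R ω, x) ∈ S} ≤ c) :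
    μ.real {ω | R ω ∈ A ∧ (R ω, X ω) ∈ S} ≤ c * μ.real {ω | R ω ∈ A} := by
  have := Measure.isProbabilityMeasure_map hX.aemeasurable (μ := μ)
  have hAS : MeasurableSet (Prod.fst ⁻¹' A ∩ S) := (measurable_fst hA).inter hS
  have h1 : μ {ω | R ω ∈ A ∧ (R ω, X ω) ∈ S} ≤ ENNReal.ofReal c * μ {ω | R ω ∈ A} := by
    rw [show {ω | R ω ∈ A ∧ (R ω, X ω) ∈ S} = (fun ω => (R ω, X ω)) ⁻¹' (Prod.fst ⁻¹' A ∩ S)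
      from rfl, ← Measure.map_apply (hR.prodMk hX) hAS,
      (indepFun_iff_map_prod_eq_prod_map_map hR.aemeasurable hX.aemeasurable).1 hind,
      Measure.prod_apply hAS, lintegral_map (measurable_measure_prodMk_left hAS) hR]
    calc _ ≤ ∫⁻ ω, {ω | R ω ∈ A}.indicator (fun _ => ENNReal.ofReal c) ω ∂μ := by
          refine lintegral_mono_ae ?_
          filter_upwards [h] with ω hω
          by_cases hRA : R ω ∈ A
          · rw [Set.indicator_of_mem (show ω ∈ {ω | R ω ∈ A} from hRA)]
            refine (measure_mono (t := {x | (R ω, x) ∈ S}) fun x hx => hx.2).trans ?_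
            exact (ENNReal.le_ofReal_iff_toReal_le (measure_ne_top _ _) hc).2 hω
          · rw [Set.indicator_of_notMem (show ω ∉ {ω | R ω ∈ A} from hRA)]
            have : Prod.mk (R ω) ⁻¹' (Prod.fst ⁻¹' A ∩ S) = ∅ := by
              ext x; simp [hRA]
            rw [this, measure_empty]
      _ = _ := by rw [lintegral_indicator (show MeasurableSet {ω | R ω ∈ A} from hR hA),
            lintegral_const, Measure.restrict_apply_univ]
  rw [measureReal_def, measureReal_def, ← ENNReal.toReal_ofReal hc, ← ENNReal.toReal_mul]
  exact ENNReal.toReal_mono (ENNReal.mul_ne_top ENNReal.ofReal_ne_top (measure_ne_top _ _)) h1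

/-- Conditionally on an event `A` determined by the points `P l`, `l ∈ S`, a triangle
with two vertices in `S` and a third one outside is nearly flat with probability
at most `c`. -/
theorem measureReal_inter_isFlat_le (hUo : IsOpen U) (hPm : ∀ i, Measurable (P i))
    (hPind : iIndepFun P μ) (hPunif : ∀ i, μ.map (P i) = uniformLaw U) {δ c : ℝ} (hc : 0 ≤ c)
    (hflat : ∀ x ∈ U, ∀ y, (uniformLaw U).real {z | IsFlat δ x y z} ≤ c)
    {S : Finset ℕ} {i j k : ℕ} (hi : i ∈ S) (hj : j ∈ S) (hk : k ∉ S)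
    {A : Set (S → EuclideanSpace ℝ (Fin (m + 1)))} (hA : MeasurableSet A) :
    μ.real {ω | (fun l : S => P l ω) ∈ A ∧ IsFlat δ (P i ω) (P j ω) (P k ω)} ≤
      c * μ.real {ω | (fun l : S => P l ω) ∈ A} := by
  have hind : IndepFun (fun ω (l : S) => P l ω) (P k) μ := by
    have h := hPind.indepFun_finset S {k} (Finset.disjoint_singleton_right.2 hk) hPm
    exact h.comp (φ := id) (ψ := fun r : ({k} : Finset ℕ) → EuclideanSpace ℝ (Fin (m + 1)) =>
      r ⟨k, Finset.mem_singleton_self k⟩) measurable_id (measurable_pi_apply _)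
  refine measureReal_inter_le_of_indepFun (R := fun ω (l : S) => P l ω) (X := P k)
    (S := {q | IsFlat δ (q.1 ⟨i, hi⟩) (q.1 ⟨j, hj⟩) q.2})
    (measurable_pi_iff.2 fun l => hPm l) (hPm k) hind hA
    (measurableSet_isFlat δ (by fun_prop) (by fun_prop) (by fun_prop)) hc ?_
  have hmem : ∀ᵐ ω ∂μ, P i ω ∈ U :=
    (ae_map_iff (hPm i).aemeasurable hUo.measurableSet).1 (hPunif i ▸ ae_mem_uniformLaw hUo)
  filter_upwards [hmem] with ω hω
  rw [hPunif]
  exact hflat _ hω _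

theorem integral_flatIndicator_eq (hPm : ∀ i, Measurable (P i)) (hPind : iIndepFun P μ)
    (hPunif : ∀ i, μ.map (P i) = uniformLaw U) [IsProbabilityMeasure (uniformLaw U)] {δ : ℝ}
    (h1 : δ < Real.pi / 2) {t : Finset ℕ} (ht : t.card = 3) :
    ∫ ω, flatIndicator δ t (fun i => P i ω) ∂μ =
      3 * ∫ p, (uniformLaw U).real (spindle δ p.1 p.2)
        ∂((uniformLaw U).prod (uniformLaw U)) := by
  rw [integral_flatIndicator hPm δ ht]
  obtain ⟨i, j, k, hij, hik, hjk, rfl⟩ := Finset.card_eq_three.1 ht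
  simp only [hasFlatTriangle_triple hij hik hjk]
  exact measureReal_isFlat hPm hPind hPunif h1 hij hik hjk

theorem integral_flatIndicator_le (hUo : IsOpen U) (hPm : ∀ i, Measurable (P i))
    (hPind : iIndepFun P μ) (hPunif : ∀ i, μ.map (P i) = uniformLaw U) {δ c : ℝ} (hc : 0 ≤ c)
    (hflat : ∀ x ∈ U, ∀ y, (uniformLaw U).real {z | IsFlat δ x y z} ≤ c)
    {t : Finset ℕ} (ht : t.card = 3) :
    ∫ ω, flatIndicator δ t (fun i => P i ω) ∂μ ≤ c := by
  rw [integral_flatIndicator hPm δ ht]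
  obtain ⟨i, j, k, hij, hik, hjk, rfl⟩ := Finset.card_eq_three.1 ht
  simp only [hasFlatTriangle_triple hij hik hjk]
  have := measureReal_inter_isFlat_le hUo hPm hPind hPunif hc hflat (S := {i, j}) (i := i) (j := j)
    (k := k) (by simp) (by simp) (by simp [hik.symm, hjk.symm]) MeasurableSet.univ
  simpa using this

/-- Two distinct triples are both nearly flat with probability at most `c ^ 2`, even if they share
points: the second has a vertex outside the first, on which one conditions last. -/
theorem integral_flatIndicator_mul_le (hUo : IsOpen U) (hPm : ∀ i, Measurable (P i))
    (hPind : iIndepFun P μ) (hPunif : ∀ i, μ.map (P i) = uniformLaw U) {δ c : ℝ} (hc : 0 ≤ c)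
    (hflat : ∀ x ∈ U, ∀ y, (uniformLaw U).real {z | IsFlat δ x y z} ≤ c)
    {s t : Finset ℕ} (hs : s.card = 3) (ht : t.card = 3) (hst : t ≠ s) :
    ∫ ω, flatIndicator δ s (fun i => P i ω) * flatIndicator δ t (fun i => P i ω) ∂μ ≤ c ^ 2 := by
  obtain ⟨k, hkt, hks⟩ : ∃ k ∈ t, k ∉ s := by
    by_contra! h
    exact hst (Finset.eq_of_subset_of_card_le h (by omega))
  have hcard : (t.erase k).card = 2 := by rw [Finset.card_erase_of_mem hkt, ht]
  obtain ⟨i, j, hij, hek⟩ := Finset.card_eq_two.1 hcard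
  have hik : i ≠ k := fun h => by
    have : i ∈ t.erase k := by rw [hek]; simp
    exact (Finset.mem_erase.1 this).1 h
  have hjk : j ≠ k := fun h => by
    have : j ∈ t.erase k := by rw [hek]; simp
    exact (Finset.mem_erase.1 this).1 h
  have ht' : t = {i, j, k} := by
    rw [← Finset.insert_erase hkt, hek]; ext; simp; tauto
  rw [integral_flatIndicator_mul hPm δ hs ht]
  subst ht'
  simp only [hasFlatTriangle_triple hij hik hjk]
  have hA : MeasurableSet {r : (s ∪ {i, j} : Finset ℕ) → EuclideanSpace ℝ (Fin (m + 1)) |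
      HasFlatTriangle δ s (extendZero _ r)} :=
    measurable_extendZero _ (measurableSet_hasFlatTriangle δ hs)
  have hext (ω) : HasFlatTriangle δ s (extendZero (s ∪ {i, j}) fun l => P l ω) ↔
      HasFlatTriangle δ s fun l => P l ω :=
    hasFlatTriangle_congr fun l hl => by simp [extendZero, hl]
  have h := measureReal_inter_isFlat_le hUo hPm hPind hPunif hc hflat (S := s ∪ {i, j}) (i := i)
    (j := j) (k := k) (by simp) (by simp) (by simp [hks, hik.symm, hjk.symm]) hA
  simp only [Set.mem_ofPred_eq, hext] at h
  refine h.trans ?_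
  rw [sq, ← integral_flatIndicator hPm δ hs]
  exact mul_le_mul_of_nonneg_left
    (integral_flatIndicator_le hUo hPm hPind hPunif hc hflat hs) hc

theorem card_filter_triples_not_disjoint_le {n : ℕ} {t : Finset ℕ} (ht : t.card = 3) :
    ((triples n).filter fun q => ¬ Disjoint q t).card ≤ 3 * n ^ 2 := by
  have hsub : ((triples n).filter fun q => ¬ Disjoint q t) ⊆
      (t ×ˢ Finset.range n ×ˢ Finset.range n).image
        fun a : ℕ × ℕ × ℕ => ({a.1, a.2.1, a.2.2} : Finset ℕ) := by
    intro q hq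
    obtain ⟨hqn, hqt⟩ := Finset.mem_filter.1 hq
    obtain ⟨hqr, hq3⟩ := mem_triples.1 hqn
    obtain ⟨i, hiq, hit⟩ := Finset.not_disjoint_iff.1 hqt
    have hcard : (q.erase i).card = 2 := by rw [Finset.card_erase_of_mem hiq, hq3]
    obtain ⟨j, k, -, hjk⟩ := Finset.card_eq_two.1 hcard
    have hj : j ∈ q := Finset.mem_of_mem_erase (a := i) (by rw [hjk]; simp)
    have hk : k ∈ q := Finset.mem_of_mem_erase (a := i) (by rw [hjk]; simp)
    refine Finset.mem_image.2 ⟨(i, j, k), ?_, ?_⟩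
    · simp only [Finset.mem_product]; exact ⟨hit, hqr hj, hqr hk⟩
    · rw [← Finset.insert_erase hiq, hjk]
  refine (Finset.card_le_card hsub).trans (Finset.card_image_le.trans ?_)
  simp only [Finset.card_product, Finset.card_range, ht]
  rw [sq]

/-- Poisson approximation for nearly flat triangles: if a triangle with two given vertices
is nearly flat with probability at most `c`, then the probability that there is none is within
`6 n ^ 5 c ^ 2` of its Poisson heuristic. -/
theorem abs_measureReal_no_flat_sub_exp_le (hUo : IsOpen U) (hPm : ∀ i, Measurable (P i))
    (hPind : iIndepFun P μ) (hPunif : ∀ i, μ.map (P i) = uniformLaw U)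
    [IsProbabilityMeasure (uniformLaw U)] {δ c : ℝ}
    (h1 : δ < Real.pi / 2) (hc : 0 ≤ c)
    (hflat : ∀ x ∈ U, ∀ y, (uniformLaw U).real {z | IsFlat δ x y z} ≤ c) (n : ℕ) :
    |μ.real {ω | ∀ t ∈ triples n, ¬ HasFlatTriangle δ t fun i => P i ω} -
      Real.exp (-(n.choose 3 * (3 * ∫ p, (uniformLaw U).real (spindle δ p.1 p.2)
        ∂((uniformLaw U).prod (uniformLaw U)))))| ≤ 6 * n ^ 5 * c ^ 2 := by
  have hcard (t) (ht : t ∈ triples n) : t.card = 3 := (mem_triples.1 ht).2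
  have key := abs_integral_prod_one_sub_sub_exp_le (μ := μ) (T := triples n)
    (I := fun t ω => flatIndicator δ t fun i => P i ω)
    (fun t ht => (measurable_flatIndicator δ (hcard t ht)).comp (measurable_path hPm))
    (fun t _ ω => flatIndicator_nonneg δ t _) (fun t _ ω => flatIndicator_le_one δ t _)
    (N := fun t => (triples n).filter fun q => ¬ Disjoint q t)
    (fun t ht => Finset.mem_filter.2 ⟨ht, by
      rw [disjoint_self, Finset.bot_eq_empty, ← Finset.card_eq_zero, hcard t ht]; norm_num⟩)
    (fun t ht => Finset.filter_subset _ _)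
    (fun t ht s => indepFun_flatIndicator_prod hPm hPind δ s (hcard t ht) fun q hq => by
      obtain ⟨hq1, hq2⟩ := Finset.mem_sdiff.1 hq
      refine ⟨hcard q hq1, ?_⟩
      by_contra h
      exact hq2 (Finset.mem_filter.2 ⟨hq1, h⟩))
  have hB : MeasurableSet {ω | ∀ t ∈ triples n, ¬ HasFlatTriangle δ t fun i => P i ω} := by
    have : {ω | ∀ t ∈ triples n, ¬ HasFlatTriangle δ t fun i => P i ω} =
        ⋂ t ∈ triples n, {ω | HasFlatTriangle δ t fun i => P i ω}ᶜ := by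
      ext ω; simp
    rw [this]
    exact Finset.measurableSet_biInter _ fun t ht =>
      (measurable_path hPm (measurableSet_hasFlatTriangle δ (hcard t ht))).compl
  have hprod : ∫ ω, ∏ t ∈ triples n, (1 - flatIndicator δ t fun i => P i ω) ∂μ =
      μ.real {ω | ∀ t ∈ triples n, ¬ HasFlatTriangle δ t fun i => P i ω} := by
    rw [← integral_indicator_one hB]
    refine integral_congr_ae (Eventually.of_forall fun ω => ?_)
    by_cases h : ∀ t ∈ triples n, ¬ HasFlatTriangle δ t fun i => P i ω
    · simp only [Set.indicator_of_mem
        (show ω ∈ {ω | ∀ t ∈ triples n, ¬ HasFlatTriangle δ t fun i => P i ω} from h),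
        Pi.one_apply]
      refine Finset.prod_eq_one fun t ht => ?_
      rw [flatIndicator_of_not_hasFlatTriangle (h t ht), sub_zero]
    · simp only [Set.indicator_of_notMem
        (show ω ∉ {ω | ∀ t ∈ triples n, ¬ HasFlatTriangle δ t fun i => P i ω} from h)]
      push Not at h
      obtain ⟨t, ht, hft⟩ := h
      refine Finset.prod_eq_zero ht ?_
      rw [flatIndicator_of_hasFlatTriangle hft, sub_self]
  have hsum : ∑ t ∈ triples n, ∫ ω, flatIndicator δ t (fun i => P i ω) ∂μ =
      n.choose 3 * (3 * ∫ p, (uniformLaw U).real (spindle δ p.1 p.2)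
        ∂((uniformLaw U).prod (uniformLaw U))) := by
    rw [Finset.sum_congr rfl fun t ht =>
      integral_flatIndicator_eq hPm hPind hPunif h1 (hcard t ht), Finset.sum_const, nsmul_eq_mul]
    simp [triples]
  rw [hprod, hsum] at key
  refine key.trans ?_
  have hn3 : ((triples n).card : ℝ) ≤ n ^ 3 := by
    have : (triples n).card ≤ n ^ 3 := by
      simp only [triples, Finset.card_powersetCard, Finset.card_range]
      exact Nat.choose_le_pow n 3
    exact_mod_cast this
  have hle (t) (ht : t ∈ triples n) :=
    integral_flatIndicator_le (μ := μ) hUo hPm hPind hPunif hc hflat (hcard t ht)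
  have h0 (t : Finset ℕ) : 0 ≤ ∫ ω, flatIndicator δ t (fun i => P i ω) ∂μ :=
    integral_nonneg fun ω => flatIndicator_nonneg δ t _
  calc _ ≤ ∑ t ∈ triples n, (6 * n ^ 2 * c ^ 2 : ℝ) := by
        refine Finset.sum_le_sum fun t ht => ?_
        set Nt := (triples n).filter fun q => ¬ Disjoint q t with hNt
        have hNsub : Nt ⊆ triples n := Finset.filter_subset _ _
        have hNc : (Nt.card : ℝ) ≤ 3 * n ^ 2 := by
          exact_mod_cast card_filter_triples_not_disjoint_le (hcard t ht)
        have b1 : ∑ q ∈ Nt.erase t, ∫ ω, flatIndicator δ t (fun i => P i ω) *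
            flatIndicator δ q (fun i => P i ω) ∂μ ≤ 3 * n ^ 2 * c ^ 2 := by
          calc _ ≤ ∑ q ∈ Nt.erase t, c ^ 2 := Finset.sum_le_sum fun q hq =>
                integral_flatIndicator_mul_le hUo hPm hPind hPunif hc hflat (hcard t ht)
                  (hcard q (hNsub (Finset.mem_of_mem_erase hq))) (Finset.ne_of_mem_erase hq)
            _ = (Nt.erase t).card * c ^ 2 := by simp
            _ ≤ Nt.card * c ^ 2 := by
                gcongr; exact Finset.erase_subset _ _
            _ ≤ _ := by gcongr
        have b2 : ∑ q ∈ Nt, ∫ ω, flatIndicator δ q (fun i => P i ω) ∂μ ≤ 3 * n ^ 2 * c := by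
          calc _ ≤ ∑ q ∈ Nt, c := Finset.sum_le_sum fun q hq => hle q (hNsub hq)
            _ = Nt.card * c := by simp
            _ ≤ _ := by gcongr
        have b3 := mul_le_mul (hle t ht) b2 (Finset.sum_nonneg fun q _ => h0 q) hc
        linarith
    _ = (triples n).card * (6 * n ^ 2 * c ^ 2) := by simp
    _ ≤ n ^ 3 * (6 * n ^ 2 * c ^ 2) := by gcongr
    _ = _ := by ring

end Random

section Random

variable {m : ℕ} {U : Set (EuclideanSpace ℝ (Fin (m + 1)))}
  {Ω : Type*} [MeasurableSpace Ω] {μ : Measure Ω}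
  {P : ℕ → Ω → EuclideanSpace ℝ (Fin (m + 1))}

theorem measurable_maxAngle (hPm : ∀ i, Measurable (P i)) (n : ℕ) :
    Measurable fun ω => maxAngle n fun i => P i ω := by
  by_cases hn : 3 ≤ n
  · refine measurable_of_Iio fun c => ?_
    have : (fun ω => maxAngle n fun i => P i ω) ⁻¹' Set.Iio c =
        ⋂ t ∈ triples n, {ω | HasFlatTriangle (Real.pi - c) t fun i => P i ω}ᶜ := by
      ext ω
      have := maxAngle_lt_iff (δ := Real.pi - c) hn fun i => P i ω
      rw [sub_sub_cancel] at this
      simp [this]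
    rw [this]
    exact Finset.measurableSet_biInter _ fun t ht =>
      (measurable_path hPm (measurableSet_hasFlatTriangle _ (mem_triples.1 ht).2)).compl
  · have : triples n = ∅ := Finset.powersetCard_eq_empty.2 (by simpa using hn)
    simp [maxAngle, this]

theorem measurable_angleStat (K : Set (EuclideanSpace ℝ (Fin (m + 1))))
    (hPm : ∀ i, Measurable (P i)) (n : ℕ) :
    Measurable fun ω => angleStat K n fun i => P i ω := by
  unfold angleStat
  exact (((measurable_maxAngle hPm n).const_sub _).pow_const _).const_mul _

theorem lt_angleStat_iff (hm : 0 < m) {n : ℕ} (hn : 3 ≤ n) {a δ : ℝ} (hδ : 0 < δ)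
    (hU : 0 < elongation U) (h : elongation U * ((n : ℝ) ^ 3 / 6) * δ ^ m = a)
    (p : ℕ → EuclideanSpace ℝ (Fin (m + 1))) :
    a < angleStat U n p ↔ ∀ t ∈ triples n, ¬ HasFlatTriangle δ t p := by
  have hn0 : (0 : ℝ) < n := by exact_mod_cast (by omega : 0 < n)
  have hc : 0 < elongation U * ((n : ℝ) ^ 3 / 6) := by positivity
  rw [← maxAngle_lt_iff hn p, ← h, angleStat, Nat.add_sub_cancel,
    show ((Nat.factorial 3 : ℕ) : ℝ) = 6 by norm_num [Nat.factorial], mul_lt_mul_iff_right₀ hc,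
    pow_lt_pow_iff_left₀ hδ.le (sub_nonneg.2 (maxAngle_le_pi n p)) hm.ne', lt_sub_comm]

variable [IsProbabilityMeasure μ]

/-- The tail of the statistic converges to that of the exponential law: with
`λ (n ^ 3 / 6) δ ^ (d - 1) = a`, the expected number of triples that are flat up to `δ` tends to
`a`, and the error in the Poisson approximation is of order `n ^ 5 (δ ^ (d - 1)) ^ 2 = O(1 / n)`. -/
theorem tendsto_measureReal_lt_angleStat (hm : 0 < m) (hUo : IsOpen U)
    (hUb : Bornology.IsBounded U) (hUc : Convex ℝ U) (hUn : U.Nonempty)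
    (hPm : ∀ i, Measurable (P i)) (hPind : iIndepFun P μ)
    (hPunif : ∀ i, μ.map (P i) = uniformLaw U) {a : ℝ} (ha : 0 < a) :
    Tendsto (fun n : ℕ => μ.real {ω | a < angleStat U n (fun i => P i ω)}) atTop
      (𝓝 (Real.exp (-a))) := by
  have := isProbabilityMeasure_uniformLaw hUo hUb hUn
  have hlam := elongation_pos hUo hUb hUn
  set lam := elongation U with hlam_def
  obtain ⟨C, hC0, hC⟩ := exists_uniformLaw_isFlat_le hm hUo hUb
  set δ : ℕ → ℝ := fun n => (6 * a / (lam * n ^ 3)) ^ ((m : ℝ)⁻¹) with hδ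
  have hδm (n : ℕ) : δ n ^ m = 6 * a / (lam * n ^ 3) :=
    Real.rpow_inv_natCast_pow (by positivity) hm.ne'
  have hn3 : Tendsto (fun n : ℕ => (n : ℝ) ^ 3) atTop atTop :=
    (tendsto_pow_atTop (by norm_num)).comp tendsto_natCast_atTop_atTop
  have hδ0 : Tendsto δ atTop (𝓝[>] 0) := by
    refine tendsto_nhdsWithin_iff.2 ⟨?_, ?_⟩
    · have h1 : Tendsto (fun n : ℕ => 6 * a / (lam * (n : ℝ) ^ 3)) atTop (𝓝 0) :=
        tendsto_const_nhds.div_atTop (hn3.const_mul_atTop hlam)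
      have h2 := h1.rpow_const (p := (m : ℝ)⁻¹) (Or.inr (by positivity))
      rwa [Real.zero_rpow (by positivity)] at h2
    · filter_upwards [eventually_gt_atTop 0] with n hn
      have : (0 : ℝ) < n := by exact_mod_cast hn
      exact Real.rpow_pos_of_pos (by positivity) _
  set J : ℝ → ℝ := fun δ => ∫ p, (uniformLaw U).real (spindle δ p.1 p.2)
        ∂((uniformLaw U).prod (uniformLaw U)) with hJ
  have hJlim : Tendsto (fun n => J (δ n) / δ n ^ m) atTop (𝓝 (lam / 3)) :=
    (tendsto_integral_uniformLaw_spindle_div hm hUo hUb hUc hUn).comp hδ0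
  have hchoose : Tendsto (fun n : ℕ => (n.choose 3 : ℝ) * (6 / (n : ℝ) ^ 3)) atTop (𝓝 1) := by
    have h := (isEquivalent_choose 3)
    rw [Asymptotics.isEquivalent_iff_tendsto_one] at h
    · refine h.congr fun n => ?_
      simp only [Pi.div_apply, show ((Nat.factorial 3 : ℕ) : ℝ) = 6 by norm_num [Nat.factorial]]
      rw [div_div_eq_mul_div, mul_div_assoc]
    · filter_upwards [eventually_gt_atTop 0] with n hn
      have : (0 : ℝ) < n := by exact_mod_cast hn
      positivity
  have hmean : Tendsto (fun n : ℕ => (n.choose 3 : ℝ) * (3 * J (δ n))) atTop (𝓝 a) := by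
    have h := (hchoose.mul hJlim).mul_const (3 * a / lam)
    rw [show 1 * (lam / 3) * (3 * a / lam) = a by field_simp] at h
    refine h.congr' ?_
    filter_upwards [eventually_gt_atTop 0] with n hn
    have : (0 : ℝ) < n := by exact_mod_cast hn
    rw [hδm]
    field_simp
  have herr : Tendsto (fun n : ℕ => 6 * (n : ℝ) ^ 5 * (C * δ n ^ m) ^ 2) atTop (𝓝 0) := by
    have h : Tendsto (fun n : ℕ => 6 * (C * (6 * a / lam)) ^ 2 / (n : ℝ)) atTop (𝓝 0) :=
      tendsto_const_nhds.div_atTop tendsto_natCast_atTop_atTop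
    refine h.congr' ?_
    filter_upwards [eventually_gt_atTop 0] with n hn
    have : (0 : ℝ) < n := by exact_mod_cast hn
    rw [hδm]
    field_simp
  have hexp : Tendsto (fun n : ℕ => Real.exp (-((n.choose 3 : ℝ) * (3 * J (δ n))))) atTop
      (𝓝 (Real.exp (-a))) := (Real.continuous_exp.tendsto _).comp hmean.neg
  refine tendsto_of_tendsto_of_dist hexp (squeeze_zero' (Eventually.of_forall fun _ => dist_nonneg)
    ?_ herr)
  filter_upwards [eventually_ge_atTop 3,
    hδ0.eventually (eventually_lt_nhdsGT_zero (half_pos Real.pi_pos))] with n hn hδn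
  have hn0 : (0 : ℝ) < n := by exact_mod_cast (by omega : 0 < n)
  have heq : lam * ((n : ℝ) ^ 3 / 6) * δ n ^ m = a := by
    rw [hδm]; field_simp
  simp only [lt_angleStat_iff hm hn hδn.1 hlam heq]
  rw [dist_comm, Real.dist_eq]
  exact abs_measureReal_no_flat_sub_exp_le hUo hPm hPind hPunif hδn.2
    (mul_nonneg hC0 (pow_nonneg hδn.1.le m)) (hC (δ n) hδn.1 hδn.2) n

end Random

/-! ### From pointwise convergence of tails to convergence in distribution -/

/-- Pólya's theorem for the exponential distribution. -/
theorem tendstoUniformlyOn_exp_neg_of_antitone {F : ℕ → ℝ → ℝ} (hF : ∀ n, Antitone (F n))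
    (h0 : ∀ n a, 0 ≤ F n a) (h1 : ∀ n a, F n a ≤ 1)
    (hlim : ∀ a, 0 < a → Tendsto (fun n => F n a) atTop (𝓝 (Real.exp (-a)))) :
    TendstoUniformlyOn F (fun a => Real.exp (-a)) atTop (Set.Ioi 0) := by
  rw [Metric.tendstoUniformlyOn_iff]
  intro ε hε
  obtain ⟨N, hN⟩ := exists_nat_gt (2 / ε)
  have hN0 : (0 : ℝ) < N := lt_trans (by positivity) hN
  have hNε : 2 / (N : ℝ) < ε := by
    rw [div_lt_iff₀ hN0]; rw [div_lt_iff₀ hε] at hN; linarith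
  -- the quantiles `-log (k / N)` of the exponential distribution
  have hgrid : ∀ᶠ n in atTop, ∀ k ∈ Finset.Ioo 0 N,
      |F n (-Real.log (k / N)) - k / N| < 1 / N := by
    rw [Filter.eventually_all_finset]
    intro k hk
    obtain ⟨hk0, hkN⟩ := Finset.mem_Ioo.1 hk
    have hk0' : (0 : ℝ) < k := by exact_mod_cast hk0
    have hkN' : (k : ℝ) < N := by exact_mod_cast hkN
    have hpos : 0 < -Real.log (k / N) := by
      rw [neg_pos]; exact Real.log_neg (by positivity) ((div_lt_one hN0).2 hkN')
    have := hlim _ hpos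
    rw [neg_neg, Real.exp_log (by positivity)] at this
    exact (Metric.tendsto_nhds.1 this) (1 / N) (by positivity)
  filter_upwards [hgrid] with n hn a ha
  have ha : 0 < a := ha
  have he1 : Real.exp (-a) < 1 := Real.exp_lt_one_iff.2 (by linarith)
  set k := ⌊N * Real.exp (-a)⌋₊ with hk
  have hk1 : (k : ℝ) ≤ N * Real.exp (-a) := Nat.floor_le (by positivity)
  have hk2 : N * Real.exp (-a) < k + 1 := Nat.lt_floor_add_one _
  have hk1' : (k : ℝ) / N ≤ Real.exp (-a) := by rw [div_le_iff₀ hN0]; linarith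
  have hk2' : Real.exp (-a) < (k + 1) / N := by rw [lt_div_iff₀ hN0]; linarith
  have hkN : k < N := by
    have : (k : ℝ) < N := lt_of_le_of_lt hk1 (by nlinarith)
    exact_mod_cast this
  have h2N : 2 / (N : ℝ) = 1 / N + 1 / N := by ring
  have hadd : ((k : ℝ) + 1) / N = k / N + 1 / N := by ring
  have hup : F n a ≤ Real.exp (-a) + 2 / N := by
    rcases (Nat.succ_le_of_lt hkN).eq_or_lt with h | h
    · have : ((k : ℝ) + 1) / N = 1 := by
        rw [div_eq_one_iff_eq hN0.ne']; exact_mod_cast h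
      have := h1 n a
      have : 0 < 1 / (N : ℝ) := by positivity
      linarith
    · have hg := (abs_lt.1 (hn (k + 1) (Finset.mem_Ioo.2 ⟨Nat.succ_pos k, h⟩))).2
      push_cast at hg
      have : -Real.log (((k : ℝ) + 1) / N) ≤ a := by
        have := Real.log_lt_log (Real.exp_pos _) hk2'
        rw [Real.log_exp] at this
        linarith
      linarith [hF n this]
  have hlow : Real.exp (-a) - 2 / N ≤ F n a := by
    rcases Nat.eq_zero_or_pos k with h | h
    · rw [h] at hk2'
      have := h0 n a
      have : 0 < 1 / (N : ℝ) := by positivity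
      simp only [Nat.cast_zero, zero_add] at hk2'
      linarith
    · have hg := (abs_lt.1 (hn k (Finset.mem_Ioo.2 ⟨h, hkN⟩))).1
      have hk0 : (0 : ℝ) < k := by exact_mod_cast h
      have : a ≤ -Real.log ((k : ℝ) / N) := by
        have := Real.log_le_log (by positivity) hk1'
        rw [Real.log_exp] at this
        linarith
      linarith [hF n this]
  rw [Real.dist_eq, abs_lt]
  constructor <;> linarith

theorem tendsto_probabilityMeasure_of_tendsto_Iic {μs : ℕ → ProbabilityMeasure ℝ}
    {ν : ProbabilityMeasure ℝ}
    (h : ∀ x, Tendsto (fun n => (μs n : Measure ℝ).real (Set.Iic x)) atTop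
      (𝓝 ((ν : Measure ℝ).real (Set.Iic x)))) :
    Tendsto μs atTop (𝓝 ν) := by
  refine IsPiSystem.tendsto_probabilityMeasure_of_tendsto_of_mem
    (S := {s | ∃ a b : ℝ, s = Set.Ioc a b}) ?_ ?_ ?_ ?_
  · rintro _ ⟨a, b, rfl⟩ _ ⟨c, d, rfl⟩ -
    exact ⟨_, _, Set.Ioc_inter_Ioc⟩
  · rintro _ ⟨a, b, rfl⟩
    exact measurableSet_Ioc
  · intro u hu x hx
    obtain ⟨ε, hε, hsub⟩ := Metric.isOpen_iff.1 hu x hx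
    refine ⟨Set.Ioc (x - ε / 2) (x + ε / 2), ⟨_, _, rfl⟩,
      Ioc_mem_nhds (by linarith) (by linarith), fun y hy => hsub ?_⟩
    rw [Metric.mem_ball, Real.dist_eq, abs_lt]
    constructor <;> linarith [hy.1, hy.2]
  · rintro _ ⟨a, b, rfl⟩
    rw [← NNReal.tendsto_coe]
    rcases le_total b a with hba | hab
    · simp [Set.Ioc_eq_empty (not_lt.2 hba)]
    have e (ρ : ProbabilityMeasure ℝ) : ((ρ (Set.Ioc a b) : NNReal) : ℝ) =
        (ρ : Measure ℝ).real (Set.Iic b) - (ρ : Measure ℝ).real (Set.Iic a) := by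
      rw [← measureReal_sdiff (Set.Iic_subset_Iic.2 hab) measurableSet_Iic, Set.Iic_sdiff_Iic]
      rfl
    simp only [e]
    exact (h b).sub (h a)

theorem tendstoInDistribution_expMeasure_one {Ω : Type*} [MeasurableSpace Ω] {μ : Measure Ω}
    [IsProbabilityMeasure μ] {Y : ℕ → Ω → ℝ} (hYm : ∀ n, Measurable (Y n))
    (hY0 : ∀ n ω, 0 ≤ Y n ω)
    (h : ∀ a, 0 < a → Tendsto (fun n => μ.real {ω | a < Y n ω}) atTop (𝓝 (Real.exp (-a)))) :
    TendstoInDistribution Y atTop (id : ℝ → ℝ) (fun _ => μ) (expMeasure 1) := by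
  refine ⟨fun n => (hYm n).aemeasurable, aemeasurable_id,
    tendsto_probabilityMeasure_of_tendsto_Iic fun x => ?_⟩
  simp only [ProbabilityMeasure.coe_mk, Measure.map_id]
  have hcdf : (expMeasure 1).real (Set.Iic x) = if 0 ≤ x then 1 - Real.exp (-x) else 0 := by
    rw [← cdf_eq_real, cdf_expMeasure_eq one_pos, one_mul]
  have hmap (n : ℕ) : (μ.map (Y n)).real (Set.Iic x) = 1 - μ.real {ω | x < Y n ω} := by
    rw [map_measureReal_apply (hYm n) measurableSet_Iic,
      ← probReal_compl_eq_one_sub (measurableSet_lt measurable_const (hYm n))]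
    congr 1; ext ω; simp
  simp only [hmap]
  rw [hcdf]
  rcases lt_trichotomy x 0 with hx | rfl | hx
  · rw [if_neg (not_le.2 hx)]
    refine tendsto_const_nhds.congr fun n => ?_
    have : {ω | x < Y n ω} = Set.univ := by
      ext ω; simpa using hx.trans_le (hY0 n ω)
    rw [this, probReal_univ, sub_self]
  · -- at `0` the limit is read off from small positive levels
    rw [if_pos le_rfl]
    refine Tendsto.const_sub 1 ?_
    rw [neg_zero, Real.exp_zero]
    refine tendsto_order.2 ⟨fun c hc => ?_, fun c hc =>
      Eventually.of_forall fun n => measureReal_le_one.trans_lt hc⟩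
    have hcont : Tendsto (fun a : ℝ => Real.exp (-a)) (𝓝[>] 0) (𝓝 1) := by
      have : Continuous fun a : ℝ => Real.exp (-a) := by fun_prop
      simpa using (this.tendsto 0).mono_left nhdsWithin_le_nhds
    obtain ⟨a, hca, ha⟩ := ((hcont.eventually (lt_mem_nhds hc)).and self_mem_nhdsWithin).exists
    have ha : 0 < a := ha
    filter_upwards [(h a ha).eventually (lt_mem_nhds hca)] with n hn
    exact hn.trans_le (measureReal_mono fun ω (hω : a < Y n ω) => ha.trans hω)
  · rw [if_pos hx.le]
    exact (h x hx).const_sub 1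

theorem uniformLaw_interior {d : ℕ} {K : Set (EuclideanSpace ℝ (Fin d))} (hKc : Convex ℝ K) :
    uniformLaw (interior K) = uniformLaw K ∧ volume.real (interior K) = volume.real K := by
  have hae : interior K =ᵐ[volume] K := by
    refine interior_subset.eventuallyLE.antisymm ?_
    refine ae_le_set.2 (measure_mono_null ?_ (hKc.addHaar_frontier volume))
    exact Set.sdiff_subset_sdiff_left subset_closure
  have hv : volume (interior K) = volume K := measure_congr hae
  refine ⟨?_, by rw [measureReal_def, hv, measureReal_def]⟩
  rw [uniformLaw, uniformLaw, ProbabilityTheory.cond, ProbabilityTheory.cond, hv,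
    Measure.restrict_congr_set hae]

theorem elongation_interior {d : ℕ} {K : Set (EuclideanSpace ℝ (Fin d))} (hKc : Convex ℝ K) :
    elongation (interior K) = elongation K := by
  obtain ⟨h1, h2⟩ := uniformLaw_interior hKc
  rw [elongation, elongation, h1, h2]

theorem theorem1 (d : ℕ) (hd : 2 ≤ d) (K : Set (EuclideanSpace ℝ (Fin d)))
    (hKb : Bornology.IsBounded K) (hKc : Convex ℝ K) (hKi : (interior K).Nonempty)
    {Ω : Type*} [MeasurableSpace Ω] (μ : Measure Ω) [IsProbabilityMeasure μ]
    (P : ℕ → Ω → EuclideanSpace ℝ (Fin d)) (hPm : ∀ i, Measurable (P i))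
    (hPind : iIndepFun P μ) (hPunif : ∀ i, μ.map (P i) = uniformLaw K) :
    TendstoInDistribution (fun (n : ℕ) (ω : Ω) => angleStat K n (fun i => P i ω)) atTop
        (id : ℝ → ℝ) (fun _ => μ) (expMeasure 1) ∧
      (∀ a : ℝ, 0 < a →
        Tendsto (fun n : ℕ => μ.real {ω | a < angleStat K n (fun i => P i ω)}) atTop
          (𝓝 (Real.exp (-a)))) ∧
      TendstoUniformlyOn
        (fun (n : ℕ) (a : ℝ) => μ.real {ω | a < angleStat K n (fun i => P i ω)})
        (fun a : ℝ => Real.exp (-a)) atTop (Set.Ioi 0) := by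
  obtain ⟨m, rfl⟩ : ∃ m, d = m + 1 := ⟨d - 1, by omega⟩
  have hm : 0 < m := by omega
  have hIb : Bornology.IsBounded (interior K) := hKb.subset interior_subset
  have hel := elongation_interior hKc
  have hpos : 0 < elongation K := hel ▸ elongation_pos isOpen_interior hIb hKi
  have hstat (n : ℕ) (p : ℕ → EuclideanSpace ℝ (Fin (m + 1))) :
      angleStat (interior K) n p = angleStat K n p := by
    rw [angleStat, angleStat, hel]
  have hlim (a : ℝ) (ha : 0 < a) :
      Tendsto (fun n : ℕ => μ.real {ω | a < angleStat K n (fun i => P i ω)}) atTop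
        (𝓝 (Real.exp (-a))) := by
    have h := tendsto_measureReal_lt_angleStat hm isOpen_interior hIb hKc.interior hKi hPm hPind
      (fun i => (hPunif i).trans (uniformLaw_interior hKc).1.symm) ha
    simpa only [hstat] using h
  refine ⟨tendstoInDistribution_expMeasure_one (measurable_angleStat K hPm) (fun n ω => ?_) hlim,
    hlim, tendstoUniformlyOn_exp_neg_of_antitone (fun n a b hab => ?_)
      (fun n a => measureReal_nonneg) (fun n a => measureReal_le_one) hlim⟩
  · have := sub_nonneg.2 (maxAngle_le_pi n fun i => P i ω)
    unfold angleStat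
    positivity
  · exact measureReal_mono fun ω (hω : b < _) => hab.trans_lt hω
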